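/- **Notation.** For a probability measure $\mu=(\mu(k))_{k\in\mathbb Z}$ on $\mathbb Z$ let $\hat\mu(\theta)=\sum_{k\in\mathbb Z}\mu(k)e^{ik\theta}$, let $\check\mu=(\mu(-k))_{k\in\mathbb Z}$, let $*$ denote convolution on $\mathbb Z$, and let $a^{*n}$ denote the $n$-th convolution power, with $a^{*0}=\delta_0$. A set $S$ of probability measures on $\mathbb Z$ is *stable by symmetrization* if $\mu\in S$ implies $\check\mu\in S$, and *stable by convolution* if $\mu,\nu\in S$ implies $\mu*\nu\in S$. Let $\mathcal H$ be the set of probability measures $\mu$ on $\mathbb Z$ such that $\hat\mu$ is twice continuously differentiable on $[-\pi,\pi]\setminus\{0\}$ (with one-sided derivatives at $\pm\pi$) and such that there exist an even continuous function $\psi:[-\pi,\pi]\to\mathbb R$ with $\psi(0)=0$, continuously differentiable on $[-\pi,\pi]\setminus\{0\}$, and constants $c,C>0$ such that for every $\theta\in(0,\pi]$: $$|\hat\mu(\theta)|\le 1-c\,\psi(\theta),\qquad |\theta\hat\mu'(\theta)|\le C\psi(\theta),\qquad |\hat\mu'(\theta)|\le C\psi'(\theta),\qquad |\theta\hat\mu''(\theta)|\le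 C\psi'(\theta).$$ Let $\mathcal R$ be the set of Ritt probability measures on $\mathbb Z$, i.e. those with $\sup_{n\ge1}n\,\|\mu^{*n}-\mu^{*(n+1)}\|_{\ell^1(\mathbb Z)}<\infty$. **Theorem 1.3.** (i) $\mathcal H$ is convex and stable by convolution and by symmetrization. (ii) $\mathcal R$ is convex and stable by convolution and by symmetrization. (iii) For every $\mu\in\mathcal H$ there exists $C>0$ such that for every $f\in\ell^1(\mathbb Z)$ and every $\lambda\ge0$, $$\#\Big\{k\in\mathbb Z:\ \sup_{n\ge1}|\mu^{*n}*f(k)|>\lambda\Big\}\le\frac C\lambda\,\|f\|_{\ell^1(\mathbb Z)},$$ where for $\lambda=0$ the right-hand side is read as $\infty$ if $f\neq0$ and as $0$ if $f=0$. (iv) For every $\mu\in\mathcal H\cap\mathcal R$ and every integer $m\ge0$ there exists $C_m>0$ such that for every $f\in\ell^1(\mathbb Z)$, $$\sup_{\lambda>0}\ \lambda\,\#\Big\{k\in\mathbb Z:\ \sup_{n\ge1}n^m\,|\mu^{*n}*(\delta_0-\mu)^{*m}*f(k)|\ge\lambda\Big\}\le C_m\|f\|_{\ell^1(\mathbb Z)}.$$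 -/

import Mathlib

open MeasureTheory
open scoped ENNReal NNReal

noncomputable section

namespace RittZ

/-- Convolution of two sequences on `ℤ`: `(a * b)(k) = ∑_j a(j) b(k - j)`.
It is only used for sequences in `ℓ¹(ℤ)`, where the series converges absolutely. -/
def conv (a b : ℤ → ℂ) : ℤ → ℂ := fun k => ∑' j : ℤ, a j * b (k - j)

/-- The sequence of the Dirac mass `δ₀`. -/
def delta0 : ℤ → ℂ := fun k => if k = 0 then 1 else 0

/-- Convolution powers `a^{*n}`, with `a^{*0} = δ₀`. -/
def convPow (a : ℤ → ℂ) : ℕ → ℤ → ℂ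
  | 0 => delta0
  | n + 1 => conv (convPow a n) a

/-- The sequence `(μ(k))_{k ∈ ℤ}`, `μ(k) = μ({k})`, of a finite measure `μ` on `ℤ`. -/
def mass (μ : Measure ℤ) : ℤ → ℂ := fun k => ((μ.real {k} : ℝ) : ℂ)

/-- The norm of `ℓ¹(ℤ)`, `‖a‖ = ∑_k |a(k)|`, with the value `∞` allowed. -/
def l1norm (a : ℤ → ℂ) : ℝ≥0∞ := eLpNorm a 1 Measure.count

/-- The Fourier transform `μ̂(θ) = ∑_k μ(k) e^{ikθ}`: the characteristic function of `μ`, seen as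
a measure on `ℝ`. -/
def fourierZ (μ : Measure ℤ) : ℝ → ℂ := charFun (μ.map (fun k : ℤ => (k : ℝ)))

/-- The set `[-π, π] - {0}`. -/
def punctured : Set ℝ := Set.Icc (-Real.pi) Real.pi \ {0}

/-- The set of the probability measures on `ℤ` that satisfy hypothesis **(H)**.
Derivatives are taken within `[-π, π] - {0}`: they are the usual ones at the interior points, and
one-sided at `±π`. -/
def classH : Set (Measure ℤ) :=
  {μ | IsProbabilityMeasure μ ∧ ContDiffOn ℝ 2 (fourierZ μ) punctured ∧
    ∃ (ψ : ℝ → ℝ) (c C : ℝ), 0 < c ∧ 0 < C ∧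
      (∀ θ ∈ Set.Icc (-Real.pi) Real.pi, ψ (-θ) = ψ θ) ∧
      ContinuousOn ψ (Set.Icc (-Real.pi) Real.pi) ∧
      ψ 0 = 0 ∧
      ContDiffOn ℝ 1 ψ punctured ∧
      ∀ θ ∈ Set.Ioc 0 Real.pi,
        ‖fourierZ μ θ‖ ≤ 1 - c * ψ θ ∧
        ‖(θ : ℂ) * derivWithin (fourierZ μ) punctured θ‖ ≤ C * ψ θ ∧
        ‖derivWithin (fourierZ μ) punctured θ‖ ≤ C * derivWithin ψ punctured θ ∧
        ‖(θ : ℂ) * iteratedDerivWithin 2 (fourierZ μ) punctured θ‖ ≤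
          C * derivWithin ψ punctured θ}

/-- The set of the Ritt probability measures on `ℤ`:
`sup_{n ≥ 1} n ‖μ^{*n} - μ^{*(n+1)}‖_{ℓ¹} < ∞`. -/
def classR : Set (Measure ℤ) :=
  {μ | IsProbabilityMeasure μ ∧
    ⨆ n : ℕ, ⨆ _ : 1 ≤ n,
      (n : ℝ≥0∞) * l1norm (convPow (mass μ) n - convPow (mass μ) (n + 1)) < ∞}

/-- `S` is stable by convolution. -/
def StableByConvolution (S : Set (Measure ℤ)) : Prop :=
  ∀ μ ∈ S, ∀ ν ∈ S, Measure.conv μ ν ∈ S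

/-- `S` is stable by symmetrization: with `μ = (μ(n))` it contains `μ̌ = (μ(-n))`. -/
def StableBySymmetrization (S : Set (Measure ℤ)) : Prop :=
  ∀ μ ∈ S, μ.map (fun k : ℤ => -k) ∈ S

/-- The maximal function `sup_{n ≥ 1} |μ^{*n} * f (k)|`. -/
def maximal (μ : Measure ℤ) (f : ℤ → ℂ) (k : ℤ) : ℝ≥0∞ :=
  ⨆ n : ℕ, ⨆ _ : 1 ≤ n, ‖conv (convPow (mass μ) n) f k‖ₑ

/-- The maximal function `sup_{n ≥ 1} n^m |μ^{*n} * (δ₀ - μ)^{*m} * f (k)|`. -/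
def weightedMaximal (μ : Measure ℤ) (m : ℕ) (f : ℤ → ℂ) (k : ℤ) : ℝ≥0∞ :=
  ⨆ n : ℕ, ⨆ _ : 1 ≤ n,
    (n : ℝ≥0∞) ^ m *
      ‖conv (conv (convPow (mass μ) n) (convPow (delta0 - mass μ) m)) f k‖ₑ

/-- There is `C > 0` such that, for all `f ∈ ℓ¹(ℤ)` and `t ≥ 0`,
`#{k : sup_{n ≥ 1} |μ^{*n} * f (k)| > t} ≤ (C / t) ‖f‖_{ℓ¹}`. (For `t = 0` the quotient is `∞`.) -/
def WeakMaximalInequality (μ : Measure ℤ) : Prop :=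
  ∃ C : ℝ≥0, 0 < C ∧ ∀ f : ℤ → ℂ, l1norm f < ∞ → ∀ t : ℝ≥0,
    ({k : ℤ | (t : ℝ≥0∞) < maximal μ f k}.encard : ℝ≥0∞) ≤
      (C : ℝ≥0∞) / (t : ℝ≥0∞) * l1norm f

/-- There is `C > 0` such that, for all `f ∈ ℓ¹(ℤ)`,
`sup_{t > 0} t #{k : sup_{n ≥ 1} n^m |μ^{*n} * (δ₀ - μ)^{*m} * f (k)| ≥ t} ≤ C ‖f‖_{ℓ¹}`. -/
def WeightedWeakMaximalInequality (μ : Measure ℤ) (m : ℕ) : Prop :=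
  ∃ C : ℝ≥0, 0 < C ∧ ∀ f : ℤ → ℂ, l1norm f < ∞ →
    ⨆ t : ℝ≥0, ⨆ _ : 0 < t,
      (t : ℝ≥0∞) * ({k : ℤ | (t : ℝ≥0∞) ≤ weightedMaximal μ m f k}.encard : ℝ≥0∞) ≤
      (C : ℝ≥0∞) * l1norm f

end RittZ

end

open MeasureTheory Complex
open scoped ENNReal NNReal

noncomputable section

namespace RittZ

/-! A sequence in ℓ¹(ℤ) is determined by its Fourier series (`hat_injective`), so every convolution
identity below reduces to a polynomial identity in the symbols. For the Ritt class, write p and q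
for the two symbols. Products are handled by telescoping pⁿqⁿ - pⁿ⁺¹qⁿ⁺¹, and convex combinations by
the binomial expansion of (ap + bq)ⁿ(a(1 - p) + b(1 - q)), where the factor n + 1 is absorbed by the
binomial coefficients (`sum_choose_mul_le`). For hypothesis (H), the majorants of the two measures
are added or averaged.

The maximal inequalities concern the kernels K_n = n^m μ^{*n} * (δ₀ - μ)^{*m}. They are bounded in
ℓ¹ uniformly in n: trivially if m = 0, by the Ritt property in general
(`exists_l1norm_diffKernel_le`). A Calderón–Zygmund decomposition f = g + (f - g) at a height
proportional to t then needs no ℓ² estimate: the ℓ¹ bound gives |K_n * g| ≤ t/2 everywhere. The part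
f - g is controlled off an exceptional set by a Hörmander condition with the supremum over n inside
the sum (`weak_type_of_hormander`).

That condition follows from |K_n(x) - K_n(x + 1)| ≤ D/x² with D independent of n. This difference is
a Fourier coefficient of F(θ) = n^m μ̂ⁿ(1 - μ̂)^m times 1 - e^{-iθ}, and one integrates by parts
twice on (0, π]. With U = cψ, the second derivative is at most a constant times 1 + nU'/(1 + nU)²,
which is the derivative of θ - 1/(1 + nU). Its integral is therefore bounded uniformly in n
(`IsMajorizedSymbol.exists_re_integral_le`). -/

/-! ### The convolution algebra ℓ¹(ℤ). -/

theorem l1norm_eq_tsum (a : ℤ → ℂ) : l1norm a = ∑' k, ‖a k‖ₑ := by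
  rw [l1norm, eLpNorm_one_eq_lintegral_enorm, lintegral_count]

theorem l1norm_lt_top_iff {a : ℤ → ℂ} : l1norm a < ∞ ↔ Summable a := by
  rw [l1norm_eq_tsum, ← summable_norm_iff, lt_top_iff_ne_top]
  simp only [enorm_eq_nnnorm]
  rw [ENNReal.tsum_coe_ne_top_iff_summable, ← NNReal.summable_coe]
  simp

theorem l1norm_add_le (a b : ℤ → ℂ) : l1norm (a + b) ≤ l1norm a + l1norm b := by
  simp only [l1norm_eq_tsum]
  rw [← ENNReal.tsum_add]
  exact ENNReal.tsum_le_tsum fun k => enorm_add_le _ _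

theorem l1norm_sub_le (a b : ℤ → ℂ) : l1norm (a - b) ≤ l1norm a + l1norm b := by
  simp only [l1norm_eq_tsum]
  rw [← ENNReal.tsum_add]
  exact ENNReal.tsum_le_tsum fun k => enorm_sub_le

theorem l1norm_smul (c : ℂ) (a : ℤ → ℂ) : l1norm (c • a) = ‖c‖ₑ * l1norm a := by
  simp only [l1norm_eq_tsum, Pi.smul_apply, smul_eq_mul, enorm_mul, ENNReal.tsum_mul_left]

theorem l1norm_sum_le {ι : Type*} (s : Finset ι) (a : ι → ℤ → ℂ) :
    l1norm (∑ i ∈ s, a i) ≤ ∑ i ∈ s, l1norm (a i) := by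
  classical
  induction s using Finset.induction_on with
  | empty => simp [l1norm_eq_tsum]
  | insert i s hi ih =>
    rw [Finset.sum_insert hi, Finset.sum_insert hi]
    exact (l1norm_add_le _ _).trans (by gcongr)

theorem l1norm_conv_le (a b : ℤ → ℂ) : l1norm (conv a b) ≤ l1norm a * l1norm b := by
  simp only [l1norm_eq_tsum, conv]
  calc ∑' k, ‖∑' j, a j * b (k - j)‖ₑ ≤ ∑' k, ∑' j, ‖a j‖ₑ * ‖b (k - j)‖ₑ := by
        refine ENNReal.tsum_le_tsum fun k => enorm_tsum_le_tsum_enorm.trans ?_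
        simp
    _ = ∑' j, ∑' k, ‖a j‖ₑ * ‖b (k - j)‖ₑ := ENNReal.tsum_comm
    _ = ∑' j, ‖a j‖ₑ * ∑' k, ‖b k‖ₑ := by
        refine tsum_congr fun j => ?_
        rw [ENNReal.tsum_mul_left]
        exact congrArg _ ((Equiv.subRight j).tsum_eq (fun k => ‖b k‖ₑ))
    _ = _ := ENNReal.tsum_mul_right

theorem summable_conv {a b : ℤ → ℂ} (ha : Summable a) (hb : Summable b) :
    Summable (conv a b) :=
  l1norm_lt_top_iff.1 ((l1norm_conv_le a b).trans_lt
    (ENNReal.mul_lt_top (l1norm_lt_top_iff.2 ha) (l1norm_lt_top_iff.2 hb)))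

theorem summable_delta0 : Summable delta0 :=
  summable_of_ne_finset_zero (s := {0}) fun k hk => by
    simp only [delta0, ite_eq_right_iff, one_ne_zero, imp_false]
    simpa using hk

theorem l1norm_delta0 : l1norm delta0 = 1 := by
  rw [l1norm_eq_tsum, tsum_eq_single 0]
  · simp [delta0]
  · intro k hk; simp [delta0, hk]

theorem summable_convPow {a : ℤ → ℂ} (ha : Summable a) (n : ℕ) : Summable (convPow a n) := by
  induction n with
  | zero => exact summable_delta0
  | succ n ih => exact summable_conv ih ha

theorem l1norm_convPow_le (a : ℤ → ℂ) (n : ℕ) : l1norm (convPow a n) ≤ l1norm a ^ n := by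
  induction n with
  | zero => rw [pow_zero]; exact l1norm_delta0.le
  | succ n ih => exact (l1norm_conv_le _ _).trans (by rw [pow_succ]; gcongr)

/-! ### Fourier series of summable sequences. -/

/-- The Fourier series `∑_k a(k) e^{ikθ}` of a sequence. -/
def hat (a : ℤ → ℂ) (θ : ℝ) : ℂ := ∑' k : ℤ, a k * cexp (I * k * θ)

theorem norm_character (k : ℤ) (θ : ℝ) : ‖cexp (I * k * θ)‖ = 1 := by
  have : I * k * θ = ((k * θ : ℝ) : ℂ) * I := by push_cast; ring
  rw [this, norm_exp_ofReal_mul_I]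

theorem summable_hat {a : ℤ → ℂ} (ha : Summable a) (θ : ℝ) :
    Summable fun k : ℤ => a k * cexp (I * k * θ) := by
  rw [← summable_norm_iff]
  simpa [norm_character] using ha.norm

theorem hat_add {a b : ℤ → ℂ} (ha : Summable a) (hb : Summable b) (θ : ℝ) :
    hat (a + b) θ = hat a θ + hat b θ := by
  simp only [hat, Pi.add_apply, add_mul]
  exact (summable_hat ha θ).tsum_add (summable_hat hb θ)

theorem hat_sub {a b : ℤ → ℂ} (ha : Summable a) (hb : Summable b) (θ : ℝ) :
    hat (a - b) θ = hat a θ - hat b θ := by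
  simp only [hat, Pi.sub_apply, sub_mul]
  exact (summable_hat ha θ).tsum_sub (summable_hat hb θ)

theorem hat_smul (c : ℂ) (a : ℤ → ℂ) (θ : ℝ) : hat (c • a) θ = c * hat a θ := by
  simp only [hat, Pi.smul_apply, smul_eq_mul, mul_assoc, tsum_mul_left]

theorem summable_sum_apply {ι : Type*} (s : Finset ι) {a : ι → ℤ → ℂ}
    (ha : ∀ i ∈ s, Summable (a i)) : Summable (∑ i ∈ s, a i) := by
  have := summable_sum (s := s) (f := a) ha
  convert this using 1
  ext k; simp

theorem hat_sum {ι : Type*} (s : Finset ι) {a : ι → ℤ → ℂ} (ha : ∀ i ∈ s, Summable (a i))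
    (θ : ℝ) : hat (∑ i ∈ s, a i) θ = ∑ i ∈ s, hat (a i) θ := by
  simp only [hat, Finset.sum_apply, Finset.sum_mul]
  exact Summable.tsum_finsetSum fun i hi => summable_hat (ha i hi) θ

theorem hat_delta0 (θ : ℝ) : hat delta0 θ = 1 := by
  rw [hat, tsum_eq_single 0]
  · simp [delta0]
  · intro k hk; simp [delta0, hk]

theorem summable_conv_prod {a b : ℤ → ℂ} (ha : Summable a) (hb : Summable b) :
    Summable fun p : ℤ × ℤ => a p.1 * b (p.2 - p.1) := by
  have h := summable_mul_of_summable_norm ha.norm hb.norm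
  let e : ℤ × ℤ ≃ ℤ × ℤ :=
    ⟨fun p => (p.1, p.2 - p.1), fun p => (p.1, p.2 + p.1), fun p => by simp, fun p => by simp⟩
  exact (e.summable_iff (f := fun p : ℤ × ℤ => a p.1 * b p.2)).2 h

theorem hat_conv {a b : ℤ → ℂ} (ha : Summable a) (hb : Summable b) (θ : ℝ) :
    hat (conv a b) θ = hat a θ * hat b θ := by
  have hs := summable_conv_prod (summable_hat ha θ) (summable_hat hb θ)
  have he : ∀ j k : ℤ, a j * cexp (I * j * θ) * (b (k - j) * cexp (I * (k - j : ℤ) * θ)) =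
      a j * b (k - j) * cexp (I * k * θ) := by
    intro j k
    have : cexp (I * k * θ) = cexp (I * j * θ) * cexp (I * (k - j : ℤ) * θ) := by
      rw [← Complex.exp_add]; congr 1; push_cast; ring
    rw [this]; ring
  calc hat (conv a b) θ
      = ∑' k : ℤ, ∑' j : ℤ, a j * cexp (I * j * θ) * (b (k - j) * cexp (I * (k - j : ℤ) * θ)) := by
        simp only [hat, conv, he, tsum_mul_right]
    _ = ∑' j : ℤ, ∑' k : ℤ, a j * cexp (I * j * θ) * (b (k - j) * cexp (I * (k - j : ℤ) * θ)) :=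
        hs.tsum_comm
    _ = ∑' j : ℤ, a j * cexp (I * j * θ) * hat b θ := by
        refine tsum_congr fun j => ?_
        rw [tsum_mul_left, hat]
        congr 1
        exact (Equiv.subRight j).tsum_eq (fun k : ℤ => b k * cexp (I * k * θ))
    _ = _ := by rw [tsum_mul_right, ← hat]

theorem hat_convPow {a : ℤ → ℂ} (ha : Summable a) (n : ℕ) (θ : ℝ) :
    hat (convPow a n) θ = hat a θ ^ n := by
  induction n with
  | zero => simp [convPow, hat_delta0]
  | succ n ih => rw [convPow, hat_conv (summable_convPow ha n) ha, ih, pow_succ]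

theorem integral_character (k : ℤ) :
    ∫ θ in -Real.pi..Real.pi, cexp (I * k * θ) = if k = 0 then 2 * (Real.pi : ℂ) else 0 := by
  split_ifs with hk
  · simp [hk]; ring
  · rw [integral_exp_mul_complex (by simp [hk, I_ne_zero])]
    have : cexp (I * k * (Real.pi : ℝ)) = cexp (I * k * (-Real.pi : ℝ)) := by
      rw [Complex.exp_eq_exp_iff_exists_int]
      exact ⟨k, by push_cast; ring⟩
    rw [this]; simp

theorem integral_hat_mul {a : ℤ → ℂ} (ha : Summable a) (k : ℤ) :
    ∫ θ in -Real.pi..Real.pi, hat a θ * cexp (-(I * k * θ)) = 2 * Real.pi * a k := by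
  have h1 : ∀ θ : ℝ, hat a θ * cexp (-(I * k * θ)) =
      ∑' j : ℤ, a j * cexp (I * (j - k : ℤ) * θ) := by
    intro θ
    rw [hat, ← tsum_mul_right]
    refine tsum_congr fun j => ?_
    rw [mul_assoc, ← Complex.exp_add]
    congr 2; push_cast; ring
  simp only [h1]
  have h2 := intervalIntegral.tsum_intervalIntegral_eq_of_summable_norm (a := -Real.pi)
    (b := Real.pi) (f := fun j : ℤ => ⟨fun θ : ℝ => a j * cexp (I * (j - k : ℤ) * θ), by fun_prop⟩)
    ?_
  · simp only [ContinuousMap.coe_mk] at h2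
    rw [← h2]
    simp only [intervalIntegral.integral_const_mul, integral_character]
    rw [tsum_eq_single k]
    · simp; ring
    · intro j hj; simp [sub_eq_zero, hj]
  · refine Summable.of_nonneg_of_le (fun _ => norm_nonneg _) (fun j => ?_) ha.norm
    rw [ContinuousMap.norm_le _ (norm_nonneg _)]
    intro θ
    simp only [ContinuousMap.restrict_apply, ContinuousMap.coe_mk, norm_mul, norm_character,
      mul_one, le_refl]

/-- The coefficients are recovered by integrating against characters. This is what lets identities
between convolution products be checked pointwise in θ by `ring`. -/
theorem hat_injective {a b : ℤ → ℂ} (ha : Summable a) (hb : Summable b)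
    (h : ∀ θ, hat a θ = hat b θ) : a = b := by
  ext k
  have h1 := integral_hat_mul ha k
  simp only [h] at h1
  rw [integral_hat_mul hb k] at h1
  have : (2 * Real.pi : ℂ) ≠ 0 := by simp [Real.pi_ne_zero]
  exact (mul_left_cancel₀ this h1).symm

/-! ### Probability measures on ℤ and their characteristic functions. -/

theorem l1norm_mass (μ : Measure ℤ) [IsProbabilityMeasure μ] : l1norm (mass μ) = 1 := by
  rw [l1norm_eq_tsum]
  have : ∀ k, ‖mass μ k‖ₑ = μ {k} := by
    intro k
    rw [← ofReal_norm]
    simp [mass, Measure.real]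
  simp only [this]
  have h := lintegral_countable' (μ := μ) (fun _ => 1)
  simpa using h.symm

theorem summable_mass (μ : Measure ℤ) [IsProbabilityMeasure μ] : Summable (mass μ) :=
  l1norm_lt_top_iff.1 (by rw [l1norm_mass]; exact ENNReal.one_lt_top)

theorem fourierZ_eq_integral (μ : Measure ℤ) (θ : ℝ) :
    fourierZ μ θ = ∫ k : ℤ, cexp (I * k * θ) ∂μ := by
  rw [fourierZ, charFun_apply_real, integral_map (by fun_prop) (by fun_prop)]
  refine integral_congr_ae (Filter.Eventually.of_forall fun k => ?_)
  simp only
  congr 1; push_cast; ring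

theorem integrable_character (μ : Measure ℤ) [IsFiniteMeasure μ] (θ : ℝ) :
    Integrable (fun k : ℤ => cexp (I * k * θ)) μ :=
  Integrable.of_bound (C := 1) (by fun_prop)
    (Filter.Eventually.of_forall fun k => (norm_character k θ).le)

theorem hat_mass (μ : Measure ℤ) [IsProbabilityMeasure μ] (θ : ℝ) :
    hat (mass μ) θ = fourierZ μ θ := by
  rw [fourierZ_eq_integral, integral_countable (integrable_character μ θ)]
  simp [hat, mass]

instance isProbabilityMeasure_map_intCast (μ : Measure ℤ) [IsProbabilityMeasure μ] :
    IsProbabilityMeasure (μ.map (fun k : ℤ => (k : ℝ))) :=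
  Measure.isProbabilityMeasure_map (by fun_prop)

theorem continuous_fourierZ (μ : Measure ℤ) [IsProbabilityMeasure μ] : Continuous (fourierZ μ) :=
  continuous_charFun

theorem fourierZ_neg (μ : Measure ℤ) (θ : ℝ) :
    fourierZ μ (-θ) = (starRingEnd ℂ) (fourierZ μ θ) := charFun_neg θ

theorem fourierZ_zero (μ : Measure ℤ) [IsProbabilityMeasure μ] : fourierZ μ 0 = 1 := by
  simp [fourierZ, charFun_zero]

theorem fourierZ_conv (μ ν : Measure ℤ) [IsProbabilityMeasure μ] [IsProbabilityMeasure ν]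
    (θ : ℝ) : fourierZ (Measure.conv μ ν) θ = fourierZ μ θ * fourierZ ν θ := by
  have h := Measure.map_conv_addMonoidHom (μ := μ) (ν := ν) (Int.castAddHom ℝ)
    (measurable_of_countable _)
  have h' : (Measure.conv μ ν).map (fun k : ℤ => (k : ℝ)) =
      Measure.conv (μ.map (fun k : ℤ => (k : ℝ))) (ν.map (fun k : ℤ => (k : ℝ))) := h
  rw [fourierZ, h', charFun_conv]
  rfl

theorem fourierZ_map_neg (μ : Measure ℤ) (θ : ℝ) :
    fourierZ (μ.map (fun k : ℤ => -k)) θ = fourierZ μ (-θ) := by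
  rw [fourierZ_eq_integral, fourierZ_eq_integral, integral_map (by fun_prop) (by fun_prop)]
  simp

theorem fourierZ_convexComb (μ ν : Measure ℤ) [IsProbabilityMeasure μ] [IsProbabilityMeasure ν]
    (a b : ℝ≥0) (θ : ℝ) :
    fourierZ (a • μ + b • ν) θ = (a : ℂ) * fourierZ μ θ + (b : ℂ) * fourierZ ν θ := by
  simp only [fourierZ_eq_integral]
  rw [integral_add_measure ((integrable_character μ θ).smul_measure_nnreal)
    ((integrable_character ν θ).smul_measure_nnreal), integral_smul_nnreal_measure,
    integral_smul_nnreal_measure]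
  simp [NNReal.smul_def]

theorem isProbabilityMeasure_convexComb (μ ν : Measure ℤ) [IsProbabilityMeasure μ]
    [IsProbabilityMeasure ν] {a b : ℝ≥0} (hab : a + b = 1) :
    IsProbabilityMeasure (a • μ + b • ν) := by
  constructor
  simp only [Measure.coe_add, Measure.smul_apply, Pi.add_apply, measure_univ]
  rw [← add_smul, hab, one_smul]

instance isProbabilityMeasure_map_neg (μ : Measure ℤ) [IsProbabilityMeasure μ] :
    IsProbabilityMeasure (μ.map (fun k : ℤ => -k)) :=
  Measure.isProbabilityMeasure_map (by fun_prop)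

theorem l1norm_convPow_mass_le_one (μ : Measure ℤ) [IsProbabilityMeasure μ] (n : ℕ) :
    l1norm (convPow (mass μ) n) ≤ 1 := by
  simpa [l1norm_mass] using l1norm_convPow_le (mass μ) n

/-! ### The Ritt class: convolution, symmetrization, convexity. -/

/-- The difference `a^{*n} - a^{*(n+1)}` of successive convolution powers. -/
def powDiff (a : ℤ → ℂ) (n : ℕ) : ℤ → ℂ := convPow a n - convPow a (n + 1)

theorem summable_powDiff {a : ℤ → ℂ} (ha : Summable a) (n : ℕ) : Summable (powDiff a n) :=
  (summable_convPow ha n).sub (summable_convPow ha (n + 1))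

theorem hat_powDiff {a : ℤ → ℂ} (ha : Summable a) (n : ℕ) (θ : ℝ) :
    hat (powDiff a n) θ = hat a θ ^ n - hat a θ ^ (n + 1) := by
  rw [powDiff, hat_sub (summable_convPow ha n) (summable_convPow ha _), hat_convPow ha,
    hat_convPow ha]

/-- Normalizing by n + 1 and including n = 0 makes the Ritt bound usable for every term of a
binomial sum. -/
theorem mem_classR_iff {μ : Measure ℤ} :
    μ ∈ classR ↔ IsProbabilityMeasure μ ∧
      ∃ M : ℝ≥0∞, M < ∞ ∧ ∀ n : ℕ, ((n + 1 : ℕ) : ℝ≥0∞) * l1norm (powDiff (mass μ) n) ≤ M := by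
  constructor
  · rintro ⟨hμ, h⟩
    -- The bound is 2 sup + 2: the summand 2 covers n = 0, where the difference has norm at most 1 +
    -- 1, and the factor 2 covers n ≥ 1, where n + 1 ≤ 2n.
    refine ⟨hμ, _, ENNReal.add_lt_top.2
      ⟨ENNReal.mul_lt_top (a := 2) (by simp) h, ENNReal.ofNat_lt_top (n := 2)⟩, fun n => ?_⟩
    rcases Nat.eq_zero_or_pos n with rfl | hn
    · refine le_add_left ?_
      have h1 := l1norm_sub_le (convPow (mass μ) 0) (convPow (mass μ) 1)
      have h2 := l1norm_convPow_mass_le_one μ 0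
      have h3 := l1norm_convPow_mass_le_one μ 1
      simp only [zero_add, Nat.cast_one, one_mul]
      exact h1.trans ((add_le_add h2 h3).trans one_add_one_eq_two.le)
    · refine le_add_right ?_
      calc ((n + 1 : ℕ) : ℝ≥0∞) * l1norm (powDiff (mass μ) n)
          ≤ (2 * n) * l1norm (powDiff (mass μ) n) := by
            gcongr; exact_mod_cast (by omega : n + 1 ≤ 2 * n)
        _ = 2 * (n * l1norm (powDiff (mass μ) n)) := mul_assoc _ _ _
        _ ≤ _ := by
          gcongr
          exact le_iSup₂ (f := fun (n : ℕ) (_ : 1 ≤ n) =>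
            (n : ℝ≥0∞) * l1norm (convPow (mass μ) n - convPow (mass μ) (n + 1))) n hn
  · rintro ⟨hμ, M, hM, h⟩
    refine ⟨hμ, lt_of_le_of_lt (iSup₂_le fun n _ => ?_) hM⟩
    refine le_trans ?_ (h n)
    rw [powDiff]
    gcongr
    exact n.le_succ

theorem mass_conv (μ ν : Measure ℤ) [IsProbabilityMeasure μ] [IsProbabilityMeasure ν] :
    mass (Measure.conv μ ν) = conv (mass μ) (mass ν) :=
  hat_injective (summable_mass _) (summable_conv (summable_mass _) (summable_mass _)) fun θ => by
    rw [hat_mass, hat_conv (summable_mass _) (summable_mass _), hat_mass, hat_mass, fourierZ_conv]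

theorem stableByConvolution_classR : StableByConvolution classR := by
  intro μ hμ ν hν
  rw [mem_classR_iff] at *
  obtain ⟨hμ, M, hM, h⟩ := hμ
  obtain ⟨hν, M', hM', h'⟩ := hν
  refine ⟨inferInstance, M + M', ENNReal.add_lt_top.2 ⟨hM, hM'⟩, fun n => ?_⟩
  have hP := summable_mass μ
  have hQ := summable_mass ν
  have key : powDiff (mass (Measure.conv μ ν)) n =
      conv (powDiff (mass μ) n) (convPow (mass ν) n) +
        conv (convPow (mass μ) (n + 1)) (powDiff (mass ν) n) := by
    have s1 := summable_conv (summable_powDiff hP n) (summable_convPow hQ n)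
    have s2 := summable_conv (summable_convPow hP (n + 1)) (summable_powDiff hQ n)
    refine hat_injective (summable_powDiff (summable_mass _) n) (s1.add s2) fun θ => ?_
    rw [hat_add s1 s2, hat_conv (summable_powDiff hP n) (summable_convPow hQ n),
      hat_conv (summable_convPow hP (n + 1)) (summable_powDiff hQ n),
      hat_powDiff (summable_mass _), mass_conv, hat_conv hP hQ, hat_powDiff hP, hat_powDiff hQ,
      hat_convPow hP, hat_convPow hQ]
    ring
  calc ((n + 1 : ℕ) : ℝ≥0∞) * l1norm (powDiff (mass (Measure.conv μ ν)) n)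
      ≤ ((n + 1 : ℕ) : ℝ≥0∞) * (l1norm (powDiff (mass μ) n) * 1 +
          1 * l1norm (powDiff (mass ν) n)) := by
        rw [key]
        gcongr
        refine (l1norm_add_le _ _).trans (add_le_add ((l1norm_conv_le _ _).trans ?_)
          ((l1norm_conv_le _ _).trans ?_))
        · gcongr; exact l1norm_convPow_mass_le_one ν n
        · gcongr; exact l1norm_convPow_mass_le_one μ _
    _ ≤ M + M' := by
        rw [mul_one, one_mul, mul_add]
        exact add_le_add (h n) (h' n)

theorem hat_comp_neg (a : ℤ → ℂ) (θ : ℝ) : hat (fun k => a (-k)) θ = hat a (-θ) := by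
  rw [hat, hat, ← (Equiv.neg ℤ).tsum_eq]
  simp

theorem l1norm_comp_neg (a : ℤ → ℂ) : l1norm (fun k => a (-k)) = l1norm a := by
  rw [l1norm_eq_tsum, l1norm_eq_tsum]
  exact (Equiv.neg ℤ).tsum_eq (fun k => ‖a k‖ₑ)

theorem stableBySymmetrization_classR : StableBySymmetrization classR := by
  intro μ hμ
  rw [mem_classR_iff] at *
  obtain ⟨hμ, M, hM, h⟩ := hμ
  refine ⟨inferInstance, M, hM, fun n => ?_⟩
  have hP := summable_mass μ
  have key : powDiff (mass (μ.map (fun k : ℤ => -k))) n = fun k => powDiff (mass μ) n (-k) := by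
    refine hat_injective (summable_powDiff (summable_mass _) n)
      ((Equiv.neg ℤ).summable_iff.2 (summable_powDiff hP n)) fun θ => ?_
    rw [hat_comp_neg, hat_powDiff hP, hat_powDiff (summable_mass _), hat_mass, hat_mass,
      fourierZ_map_neg]
  rw [key, l1norm_comp_neg]
  exact h n

theorem enorm_nnreal_complex (w : ℝ≥0) : ‖(w : ℂ)‖ₑ = w := by
  rw [← ofReal_norm]
  simp

theorem summable_smul (c : ℂ) {a : ℤ → ℂ} (ha : Summable a) : Summable (c • a) :=
  ha.mul_left c

/-- With r = ap + bq and a + b = 1 one has 1 - r = a(1 - p) + b(1 - q). Multiplying by the binomial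
expansion of rⁿ places a factor 1 - p or 1 - q in each term, which becomes a difference of
consecutive powers. -/
theorem powDiff_convexComb {P Q R : ℤ → ℂ} (hP : Summable P) (hQ : Summable Q) (hR : Summable R)
    {a b : ℂ} (hab : a + b = 1) (h : ∀ θ, hat R θ = a * hat P θ + b * hat Q θ) (n : ℕ) :
    powDiff R n = ∑ k ∈ Finset.range (n + 1), (n.choose k * a ^ k * b ^ (n - k)) •
        (a • conv (powDiff P k) (convPow Q (n - k)) +
          b • conv (convPow P k) (powDiff Q (n - k))) := by
  have s1 : ∀ k, Summable (a • conv (powDiff P k) (convPow Q (n - k))) := fun k =>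
    summable_smul a (summable_conv (summable_powDiff hP k) (summable_convPow hQ _))
  have s2 : ∀ k, Summable (b • conv (convPow P k) (powDiff Q (n - k))) := fun k =>
    summable_smul b (summable_conv (summable_convPow hP k) (summable_powDiff hQ _))
  have s3 : ∀ k ∈ Finset.range (n + 1), Summable ((n.choose k * a ^ k * b ^ (n - k)) •
        (a • conv (powDiff P k) (convPow Q (n - k)) +
          b • conv (convPow P k) (powDiff Q (n - k)))) := fun k _ =>
    summable_smul _ ((s1 k).add (s2 k))
  refine hat_injective (summable_powDiff hR n) (summable_sum_apply _ s3) fun θ => ?_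
  rw [hat_sum _ s3, hat_powDiff hR, h]
  have e : ∀ k ∈ Finset.range (n + 1), hat ((n.choose k * a ^ k * b ^ (n - k)) •
        (a • conv (powDiff P k) (convPow Q (n - k)) +
          b • conv (convPow P k) (powDiff Q (n - k)))) θ =
      (a * hat P θ) ^ k * (b * hat Q θ) ^ (n - k) * n.choose k *
        (a * (1 - hat P θ) + b * (1 - hat Q θ)) := by
    intro k _
    rw [hat_smul, hat_add (s1 k) (s2 k), hat_smul, hat_smul,
      hat_conv (summable_powDiff hP k) (summable_convPow hQ _),
      hat_conv (summable_convPow hP k) (summable_powDiff hQ _), hat_powDiff hP, hat_powDiff hQ,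
      hat_convPow hP, hat_convPow hQ, mul_pow, mul_pow]
    ring
  rw [Finset.sum_congr rfl e, ← Finset.sum_mul, ← add_pow, pow_succ, eq_sub_of_add_eq' hab]
  ring

/-- Since (n+1)·C(n,k) equals both (k+1)·C(n+1,k+1) and (n-k+1)·C(n+1,k), the factor n + 1 turns
into the weight that each term needs. The coefficients left over are partial sums of (a + b)ⁿ⁺¹ = 1.
-/
theorem sum_choose_mul_le {a b : ℝ≥0} (hab : a + b = 1) {x y : ℕ → ℝ≥0∞} {A B : ℝ≥0∞}
    (hx : ∀ k : ℕ, ((k + 1 : ℕ) : ℝ≥0∞) * x k ≤ A) (hy : ∀ k : ℕ, ((k + 1 : ℕ) : ℝ≥0∞) * y k ≤ B)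
    (n : ℕ) :
    ((n + 1 : ℕ) : ℝ≥0∞) * ∑ k ∈ Finset.range (n + 1),
      ((n.choose k * a ^ k * b ^ (n - k) : ℝ≥0) : ℝ≥0∞) * (a * x k + b * y (n - k)) ≤ A + B := by
  have hab' : (a : ℝ≥0∞) + b = 1 := by exact_mod_cast hab
  have hbin : ∑ k ∈ Finset.range (n + 1 + 1),
      (a : ℝ≥0∞) ^ k * (b : ℝ≥0∞) ^ (n + 1 - k) * ((n + 1).choose k : ℕ) = 1 := by
    rw [← add_pow, hab', one_pow]
  have h1 : ∑ k ∈ Finset.range (n + 1),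
      (a : ℝ≥0∞) ^ (k + 1) * (b : ℝ≥0∞) ^ (n - k) * ((n + 1).choose (k + 1) : ℕ) ≤ 1 := by
    rw [← hbin, Finset.sum_range_succ' _ (n + 1)]
    simp only [Nat.add_sub_add_right]
    exact le_self_add
  have h2 : ∑ k ∈ Finset.range (n + 1),
      (a : ℝ≥0∞) ^ k * (b : ℝ≥0∞) ^ (n + 1 - k) * ((n + 1).choose k : ℕ) ≤ 1 := by
    rw [← hbin, Finset.sum_range_succ _ (n + 1)]
    exact le_self_add
  calc _ = ∑ k ∈ Finset.range (n + 1),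
        ((a : ℝ≥0∞) ^ (k + 1) * (b : ℝ≥0∞) ^ (n - k) * ((n + 1).choose (k + 1) : ℕ) *
            (((k + 1 : ℕ) : ℝ≥0∞) * x k) +
          (a : ℝ≥0∞) ^ k * (b : ℝ≥0∞) ^ (n + 1 - k) * ((n + 1).choose k : ℕ) *
            (((n - k + 1 : ℕ) : ℝ≥0∞) * y (n - k))) := by
        rw [Finset.mul_sum]
        refine Finset.sum_congr rfl fun k hk => ?_
        have hk' : k ≤ n := by simpa [Nat.lt_succ_iff] using hk
        have c1 : ((n + 1 : ℕ) : ℝ≥0∞) * (n.choose k : ℕ) =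
            ((n + 1).choose (k + 1) : ℕ) * ((k + 1 : ℕ) : ℝ≥0∞) := by
          exact_mod_cast Nat.add_one_mul_choose_eq n k
        have c2 : ((n + 1 : ℕ) : ℝ≥0∞) * (n.choose k : ℕ) =
            ((n + 1).choose k : ℕ) * ((n - k + 1 : ℕ) : ℝ≥0∞) := by
          have := Nat.choose_mul_succ_eq n k
          rw [mul_comm, show n + 1 - k = n - k + 1 by omega] at this
          exact_mod_cast this
        have e : n + 1 - k = n - k + 1 := by omega
        rw [e]
        simp only [ENNReal.coe_mul, ENNReal.coe_pow, ENNReal.coe_natCast]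
        calc _ = (((n + 1 : ℕ) : ℝ≥0∞) * (n.choose k : ℕ)) *
                  ((a : ℝ≥0∞) ^ (k + 1) * (b : ℝ≥0∞) ^ (n - k) * x k) +
                (((n + 1 : ℕ) : ℝ≥0∞) * (n.choose k : ℕ)) *
                  ((a : ℝ≥0∞) ^ k * (b : ℝ≥0∞) ^ (n - k + 1) * y (n - k)) := by ring
          _ = _ := by
            nth_rewrite 1 [c1]
            rw [c2]; ring
    _ ≤ ∑ k ∈ Finset.range (n + 1),
        ((a : ℝ≥0∞) ^ (k + 1) * (b : ℝ≥0∞) ^ (n - k) * ((n + 1).choose (k + 1) : ℕ) * A +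
          (a : ℝ≥0∞) ^ k * (b : ℝ≥0∞) ^ (n + 1 - k) * ((n + 1).choose k : ℕ) * B) := by
        refine Finset.sum_le_sum fun k _ => ?_
        gcongr
        · exact hx k
        · exact hy (n - k)
    _ ≤ A + B := by
        rw [Finset.sum_add_distrib, ← Finset.sum_mul, ← Finset.sum_mul]
        exact add_le_add (mul_le_of_le_one_left' h1) (mul_le_of_le_one_left' h2)

theorem convex_classR : Convex ℝ≥0 classR := by
  intro μ hμ ν hν a b _ _ hab
  rw [mem_classR_iff] at *
  obtain ⟨hμ, M, hM, h⟩ := hμ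
  obtain ⟨hν, M', hM', h'⟩ := hν
  have := isProbabilityMeasure_convexComb μ ν hab
  refine ⟨this, M + M', ENNReal.add_lt_top.2 ⟨hM, hM'⟩, fun n => ?_⟩
  have hab' : ((a : ℂ)) + b = 1 := by exact_mod_cast congrArg (fun x : ℝ≥0 => (x : ℂ)) hab
  rw [powDiff_convexComb (summable_mass μ) (summable_mass ν) (summable_mass _) hab'
    (fun θ => by rw [hat_mass, hat_mass, hat_mass, fourierZ_convexComb]) n]
  refine le_trans ?_ (sum_choose_mul_le hab h h' n)
  gcongr
  refine (l1norm_sum_le _ _).trans (Finset.sum_le_sum fun k _ => ?_)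
  have hc : (n.choose k * (a : ℂ) ^ k * (b : ℂ) ^ (n - k)) =
      ((n.choose k * a ^ k * b ^ (n - k) : ℝ≥0) : ℂ) := by push_cast; rfl
  rw [l1norm_smul, hc, enorm_nnreal_complex]
  gcongr
  refine (l1norm_add_le _ _).trans ?_
  rw [l1norm_smul, l1norm_smul, enorm_nnreal_complex, enorm_nnreal_complex]
  gcongr
  · exact (l1norm_conv_le _ _).trans (mul_le_of_le_one_right' (l1norm_convPow_mass_le_one ν _))
  · exact (l1norm_conv_le _ _).trans (mul_le_of_le_one_left' (l1norm_convPow_mass_le_one μ _))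

/-! ### Higher differences of convolution powers of a Ritt measure. -/

/-- The kernel `μ^{*n} * (δ₀ - μ)^{*m}`. -/
def diffKernel (μ : Measure ℤ) (m n : ℕ) : ℤ → ℂ :=
  conv (convPow (mass μ) n) (convPow (delta0 - mass μ) m)

theorem summable_diffKernel (μ : Measure ℤ) [IsProbabilityMeasure μ] (m n : ℕ) :
    Summable (diffKernel μ m n) :=
  summable_conv (summable_convPow (summable_mass μ) n)
    (summable_convPow (summable_delta0.sub (summable_mass μ)) m)

theorem hat_diffKernel (μ : Measure ℤ) [IsProbabilityMeasure μ] (m n : ℕ) (θ : ℝ) :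
    hat (diffKernel μ m n) θ = fourierZ μ θ ^ n * (1 - fourierZ μ θ) ^ m := by
  have hP := summable_mass μ
  have hD : Summable (delta0 - mass μ) := summable_delta0.sub hP
  rw [diffKernel, hat_conv (summable_convPow hP n) (summable_convPow hD m), hat_convPow hP,
    hat_convPow hD, hat_sub summable_delta0 hP, hat_delta0, hat_mass]

/-- The power μ^{*n} is cut into m blocks of length n / m plus a remainder n % m, and each block
receives one factor δ₀ - μ. Each of these m differences is O(1/(n/m + 1)), while n ≤ m(n/m + 1). For
m = 0 the conventions n / 0 = 0 and n % 0 = n keep the factorization valid. -/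
theorem exists_l1norm_diffKernel_le {μ : Measure ℤ} (hμ : μ ∈ classR) (m : ℕ) :
    ∃ M : ℝ≥0∞, M < ∞ ∧ ∀ n : ℕ, (n : ℝ≥0∞) ^ m * l1norm (diffKernel μ m n) ≤ M := by
  obtain ⟨hμ, M, hM, h⟩ := mem_classR_iff.1 hμ
  have hP := summable_mass μ
  refine ⟨(m * M) ^ m, ENNReal.pow_lt_top (ENNReal.mul_lt_top (by simp) hM), fun n => ?_⟩
  have key : diffKernel μ m n =
      conv (convPow (mass μ) (n % m)) (convPow (powDiff (mass μ) (n / m)) m) := by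
    have s := summable_powDiff hP (n / m)
    refine hat_injective (summable_diffKernel μ m n)
      (summable_conv (summable_convPow hP _) (summable_convPow s m)) fun θ => ?_
    rw [hat_diffKernel, hat_conv (summable_convPow hP _) (summable_convPow s m), hat_convPow hP,
      hat_convPow s, hat_powDiff hP, hat_mass]
    set p := fourierZ μ θ
    have e : p ^ (n / m) - p ^ (n / m + 1) = p ^ (n / m) * (1 - p) := by ring
    rw [e, mul_pow, ← pow_mul, ← mul_assoc, ← pow_add, mul_comm (n / m), Nat.mod_add_div]
  have hn : (n : ℝ≥0∞) ^ m ≤ ((m : ℝ≥0∞) * ((n / m + 1 : ℕ) : ℝ≥0∞)) ^ m := by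
    rcases Nat.eq_zero_or_pos m with rfl | hm
    · simp
    · gcongr
      have := Nat.mod_add_div n m
      have := Nat.mod_lt n hm
      exact_mod_cast (by rw [mul_add]; omega : n ≤ m * (n / m + 1))
  calc (n : ℝ≥0∞) ^ m * l1norm (diffKernel μ m n)
      ≤ ((m : ℝ≥0∞) * ((n / m + 1 : ℕ) : ℝ≥0∞)) ^ m * (1 * l1norm (powDiff (mass μ) (n / m)) ^ m) := by
        rw [key]
        gcongr
        refine (l1norm_conv_le _ _).trans ?_
        gcongr
        · exact l1norm_convPow_mass_le_one μ _
        · exact l1norm_convPow_le _ _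
    _ = (m * (((n / m + 1 : ℕ) : ℝ≥0∞) * l1norm (powDiff (mass μ) (n / m)))) ^ m := by
        rw [one_mul, ← mul_pow, mul_assoc]
    _ ≤ _ := by gcongr; exact h _

/-! ### Hypothesis (H): symmetrization, convexity, convolution. -/

theorem uniqueDiffOn_punctured : UniqueDiffOn ℝ punctured :=
  (uniqueDiffOn_Icc (by linarith [Real.pi_pos])).inter isOpen_compl_singleton

theorem mem_punctured_of_mem_Ioc {θ : ℝ} (h : θ ∈ Set.Ioc 0 Real.pi) : θ ∈ punctured :=
  ⟨⟨by linarith [h.1, Real.pi_pos], h.2⟩, ne_of_gt h.1⟩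

theorem hasDerivWithinAt_of_contDiffOn_two {f : ℝ → ℂ} {s : Set ℝ} (hs : UniqueDiffOn ℝ s)
    (hf : ContDiffOn ℝ 2 f s) {θ : ℝ} (hθ : θ ∈ s) :
    HasDerivWithinAt f (derivWithin f s θ) s θ ∧
      HasDerivWithinAt (derivWithin f s) (iteratedDerivWithin 2 f s θ) s θ := by
  refine ⟨(hf.differentiableOn (by simp) θ hθ).hasDerivWithinAt, ?_⟩
  have h1 : ContDiffOn ℝ 1 (derivWithin f s) s := hf.derivWithin hs (by norm_num)
  have h2 : iteratedDerivWithin 2 f s = derivWithin (derivWithin f s) s := by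
    rw [iteratedDerivWithin_succ, iteratedDerivWithin_one]
  rw [h2]
  exact (h1.differentiableOn (by simp) θ hθ).hasDerivWithinAt

theorem iteratedDerivWithin_two_eq {f f1 f2 : ℝ → ℂ} {s : Set ℝ} (hs : UniqueDiffOn ℝ s)
    (h1 : ∀ θ ∈ s, HasDerivWithinAt f (f1 θ) s θ) (h2 : ∀ θ ∈ s, HasDerivWithinAt f1 (f2 θ) s θ)
    {θ : ℝ} (hθ : θ ∈ s) : iteratedDerivWithin 2 f s θ = f2 θ := by
  have e : Set.EqOn (derivWithin f s) f1 s := fun x hx => (h1 x hx).derivWithin (hs x hx)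
  rw [iteratedDerivWithin_succ, iteratedDerivWithin_one, derivWithin_congr e (e hθ)]
  exact (h2 θ hθ).derivWithin (hs θ hθ)

/-- The four pointwise inequalities of hypothesis (H) for the function `f` with derivatives `f1`
and `f2`, the majorant `ψ` with derivative `ψ1` and the constants `c` and `C`. -/
def MajorizedBy (f f1 f2 : ℝ → ℂ) (ψ ψ1 : ℝ → ℝ) (c C : ℝ) : Prop :=
  ∀ θ ∈ Set.Ioc 0 Real.pi, ‖f θ‖ ≤ 1 - c * ψ θ ∧ ‖(θ : ℂ) * f1 θ‖ ≤ C * ψ θ ∧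
    ‖f1 θ‖ ≤ C * ψ1 θ ∧ ‖(θ : ℂ) * f2 θ‖ ≤ C * ψ1 θ

/-- Since C > 0, nonnegativity of ψ and ψ' is forced by the norm bounds; it is what allows the
constants to be weakened in `MajorizedBy.mono`. -/
theorem MajorizedBy.nonneg {f f1 f2 : ℝ → ℂ} {ψ ψ1 : ℝ → ℝ} {c C : ℝ} (hC : 0 < C)
    (h : MajorizedBy f f1 f2 ψ ψ1 c C) {θ : ℝ} (hθ : θ ∈ Set.Ioc 0 Real.pi) :
    0 ≤ ψ θ ∧ 0 ≤ ψ1 θ := by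
  obtain ⟨-, h2, h3, -⟩ := h θ hθ
  exact ⟨nonneg_of_mul_nonneg_right ((norm_nonneg _).trans h2) hC,
    nonneg_of_mul_nonneg_right ((norm_nonneg _).trans h3) hC⟩

theorem MajorizedBy.mono {f f1 f2 : ℝ → ℂ} {ψ ψ1 : ℝ → ℝ} {c C c' C' : ℝ} (hC : 0 < C)
    (h : MajorizedBy f f1 f2 ψ ψ1 c C) (hc : c' ≤ c) (hC' : C ≤ C') :
    MajorizedBy f f1 f2 ψ ψ1 c' C' := by
  intro θ hθ
  obtain ⟨p, p1⟩ := h.nonneg hC hθ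
  obtain ⟨h1, h2, h3, h4⟩ := h θ hθ
  refine ⟨h1.trans ?_, h2.trans ?_, h3.trans ?_, h4.trans ?_⟩ <;> gcongr

theorem mem_classH_of_majorizedBy {μ : Measure ℤ} [IsProbabilityMeasure μ] {f1 f2 : ℝ → ℂ}
    {ψ ψ1 : ℝ → ℝ} {c C : ℝ} (hc : 0 < c) (hC : 0 < C)
    (hf : ContDiffOn ℝ 2 (fourierZ μ) punctured)
    (hf1 : ∀ θ ∈ punctured, HasDerivWithinAt (fourierZ μ) (f1 θ) punctured θ)
    (hf2 : ∀ θ ∈ punctured, HasDerivWithinAt f1 (f2 θ) punctured θ)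
    (heven : ∀ θ ∈ Set.Icc (-Real.pi) Real.pi, ψ (-θ) = ψ θ)
    (hcont : ContinuousOn ψ (Set.Icc (-Real.pi) Real.pi)) (h0 : ψ 0 = 0)
    (hψ : ContDiffOn ℝ 1 ψ punctured)
    (hψ1 : ∀ θ ∈ punctured, HasDerivWithinAt ψ (ψ1 θ) punctured θ)
    (h : MajorizedBy (fourierZ μ) f1 f2 ψ ψ1 c C) : μ ∈ classH := by
  refine ⟨inferInstance, hf, ψ, c, C, hc, hC, heven, hcont, h0, hψ, fun θ hθ => ?_⟩
  have hθ' := mem_punctured_of_mem_Ioc hθ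
  have hu := uniqueDiffOn_punctured θ hθ'
  rw [(hf1 θ hθ').derivWithin hu, (hψ1 θ hθ').derivWithin hu,
    iteratedDerivWithin_two_eq uniqueDiffOn_punctured hf1 hf2 hθ']
  exact h θ hθ

theorem exists_majorizedBy_of_mem_classH {μ : Measure ℤ} (hμ : μ ∈ classH) :
    IsProbabilityMeasure μ ∧ ContDiffOn ℝ 2 (fourierZ μ) punctured ∧
      ∃ (f1 f2 : ℝ → ℂ) (ψ ψ1 : ℝ → ℝ) (c C : ℝ), 0 < c ∧ 0 < C ∧
      (∀ θ ∈ punctured, HasDerivWithinAt (fourierZ μ) (f1 θ) punctured θ) ∧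
      (∀ θ ∈ punctured, HasDerivWithinAt f1 (f2 θ) punctured θ) ∧
      (∀ θ ∈ Set.Icc (-Real.pi) Real.pi, ψ (-θ) = ψ θ) ∧
      ContinuousOn ψ (Set.Icc (-Real.pi) Real.pi) ∧ ψ 0 = 0 ∧
      ContDiffOn ℝ 1 ψ punctured ∧
      (∀ θ ∈ punctured, HasDerivWithinAt ψ (ψ1 θ) punctured θ) ∧
      MajorizedBy (fourierZ μ) f1 f2 ψ ψ1 c C := by
  obtain ⟨hp, hf, ψ, c, C, hc, hC, heven, hcont, h0, hψ, h⟩ := hμ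
  exact ⟨hp, hf, derivWithin (fourierZ μ) punctured, iteratedDerivWithin 2 (fourierZ μ) punctured,
    ψ, derivWithin ψ punctured, c, C, hc, hC,
    fun θ hθ => (hasDerivWithinAt_of_contDiffOn_two uniqueDiffOn_punctured hf hθ).1,
    fun θ hθ => (hasDerivWithinAt_of_contDiffOn_two uniqueDiffOn_punctured hf hθ).2,
    heven, hcont, h0, hψ,
    fun θ hθ => (hψ.differentiableOn (by simp) θ hθ).hasDerivWithinAt, h⟩

theorem stableBySymmetrization_classH : StableBySymmetrization classH := by
  intro μ hμ
  obtain ⟨hp, hf, f1, f2, ψ, ψ1, c, C, hc, hC, hf1, hf2, heven, hcont, h0, hψ, hψ1, h⟩ :=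
    exists_majorizedBy_of_mem_classH hμ
  have e : fourierZ (μ.map (fun k : ℤ => -k)) = fun θ => conjCLE (fourierZ μ θ) := by
    ext θ; rw [fourierZ_map_neg, fourierZ_neg]; rfl
  have hconj : ∀ {g : ℝ → ℂ} {g' : ℂ} {θ : ℝ}, HasDerivWithinAt g g' punctured θ →
      HasDerivWithinAt (fun θ => conjCLE (g θ)) (conjCLE g') punctured θ := fun hg =>
    conjCLE.toContinuousLinearMap.hasFDerivAt.comp_hasDerivWithinAt _ hg
  refine mem_classH_of_majorizedBy (f1 := fun θ => conjCLE (f1 θ)) (f2 := fun θ => conjCLE (f2 θ))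
    hc hC ?_ ?_ (fun θ hθ => hconj (hf2 θ hθ)) heven hcont h0 hψ hψ1 ?_
  · rw [e]; exact conjCLE.contDiff.comp_contDiffOn hf
  · rw [e]; exact fun θ hθ => hconj (hf1 θ hθ)
  · rw [e]
    intro θ hθ
    simpa using h θ hθ

theorem convex_classH : Convex ℝ≥0 classH := by
  intro μ hμ ν hν a b _ _ hab
  obtain ⟨hp, hf, f1, f2, ψ, ψ1, c, C, hc, hC, hf1, hf2, heven, hcont, h0, hψ, hψ1, h⟩ :=
    exists_majorizedBy_of_mem_classH hμ
  obtain ⟨hq, hg, g1, g2, φ, φ1, d, D, hd, hD, hg1, hg2, heven', hcont', h0', hφ, hφ1, h'⟩ :=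
    exists_majorizedBy_of_mem_classH hν
  have hprob := isProbabilityMeasure_convexComb μ ν hab
  have hab' : (a : ℝ) + b = 1 := by exact_mod_cast hab
  have e : fourierZ (a • μ + b • ν) =
      fun θ => (a : ℂ) * fourierZ μ θ + (b : ℂ) * fourierZ ν θ := by
    ext θ; exact fourierZ_convexComb μ ν a b θ
  refine mem_classH_of_majorizedBy (f1 := fun θ => (a : ℂ) * f1 θ + (b : ℂ) * g1 θ)
    (f2 := fun θ => (a : ℂ) * f2 θ + (b : ℂ) * g2 θ) (ψ := fun θ => a * ψ θ + b * φ θ)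
    (ψ1 := fun θ => a * ψ1 θ + b * φ1 θ) (c := min c d) (C := max C D)
    (lt_min hc hd) (lt_max_of_lt_left hC) ?_ ?_ ?_ ?_ ?_ ?_ ?_ ?_ ?_
  · rw [e]; exact (contDiffOn_const.mul hf).add (contDiffOn_const.mul hg)
  · rw [e]; exact fun θ hθ => ((hf1 θ hθ).const_mul _).add ((hg1 θ hθ).const_mul _)
  · exact fun θ hθ => ((hf2 θ hθ).const_mul _).add ((hg2 θ hθ).const_mul _)
  · intro θ hθ; simp only [heven θ hθ, heven' θ hθ]
  · exact (continuousOn_const.mul hcont).add (continuousOn_const.mul hcont')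
  · simp [h0, h0']
  · exact (contDiffOn_const.mul hψ).add (contDiffOn_const.mul hφ)
  · exact fun θ hθ => ((hψ1 θ hθ).const_mul _).add ((hφ1 θ hθ).const_mul _)
  · rw [e]
    intro θ hθ
    obtain ⟨u1, u2, u3, u4⟩ := h.mono hC (min_le_left c d) (le_max_left C D) θ hθ
    obtain ⟨v1, v2, v3, v4⟩ := h'.mono hD (min_le_right c d) (le_max_right C D) θ hθ
    have comb : ∀ {x y : ℂ} {s t : ℝ}, ‖x‖ ≤ s → ‖y‖ ≤ t →
        ‖(a : ℂ) * x + (b : ℂ) * y‖ ≤ a * s + b * t := by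
      intro x y s t hx hy
      refine (norm_add_le _ _).trans ?_
      rw [norm_mul, norm_mul]
      simp only [norm_real, NNReal.norm_eq]
      gcongr
    refine ⟨(comb u1 v1).trans (le_of_eq ?_), ?_, (comb u3 v3).trans (le_of_eq (by ring)), ?_⟩
    · linear_combination hab'
    · rw [show (θ : ℂ) * ((a : ℂ) * f1 θ + (b : ℂ) * g1 θ) =
        (a : ℂ) * (θ * f1 θ) + (b : ℂ) * (θ * g1 θ) by ring]
      exact (comb u2 v2).trans (le_of_eq (by ring))
    · rw [show (θ : ℂ) * ((a : ℂ) * f2 θ + (b : ℂ) * g2 θ) =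
        (a : ℂ) * (θ * f2 θ) + (b : ℂ) * (θ * g2 θ) by ring]
      exact (comb u4 v4).trans (le_of_eq (by ring))

/-- Since |f|, |g| ≤ 1, the modulus of fg is at most 1 - cψ and at most 1 - cφ, hence at most the
mean of the two: this is the constant c/2. In (fg)'' the new term is 2f'g'; there |θf'| ≤ Cψ ≤ C/c
and |g'| ≤ Cφ', which gives the extra 2C²/c. -/
theorem MajorizedBy.mul {f f1 f2 g g1 g2 : ℝ → ℂ} {ψ ψ1 φ φ1 : ℝ → ℝ} {c C : ℝ}
    (hc : 0 < c) (hC : 0 < C) (h : MajorizedBy f f1 f2 ψ ψ1 c C)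
    (h' : MajorizedBy g g1 g2 φ φ1 c C) :
    MajorizedBy (fun θ => f θ * g θ) (fun θ => f1 θ * g θ + f θ * g1 θ)
      (fun θ => f2 θ * g θ + f1 θ * g1 θ + (f1 θ * g1 θ + f θ * g2 θ))
      (fun θ => ψ θ + φ θ) (fun θ => ψ1 θ + φ1 θ) (c / 2) (C + 2 * C ^ 2 / c) := by
  intro θ hθ
  obtain ⟨p, p1⟩ := h.nonneg hC hθ
  obtain ⟨q, q1⟩ := h'.nonneg hC hθ
  obtain ⟨u1, u2, u3, u4⟩ := h θ hθ
  obtain ⟨v1, v2, v3, v4⟩ := h' θ hθ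
  have hcψ := mul_nonneg hc.le p
  have hcφ := mul_nonneg hc.le q
  have hf1 : ‖f θ‖ ≤ 1 := by linarith
  have hg1 : ‖g θ‖ ≤ 1 := by linarith
  -- Boundedness of ψ comes from 0 ≤ |f| ≤ 1 - cψ.
  have hψ : ψ θ ≤ 1 / c := by rw [le_div_iff₀ hc]; linarith [norm_nonneg (f θ)]
  have hle : C ≤ C + 2 * C ^ 2 / c := le_add_of_nonneg_right (by positivity)
  have hfst : ‖(θ : ℂ) * (f1 θ * g θ + f θ * g1 θ)‖ ≤ C * (ψ θ + φ θ) := by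
    rw [show (θ : ℂ) * (f1 θ * g θ + f θ * g1 θ) = (θ * f1 θ) * g θ + f θ * (θ * g1 θ) by ring]
    refine (norm_add_le _ _).trans ?_
    rw [norm_mul (_ * _) (g θ), norm_mul (f θ) (_ * _), mul_add]
    exact add_le_add ((mul_le_of_le_one_right (norm_nonneg _) hg1).trans u2)
      ((mul_le_of_le_one_left (norm_nonneg _) hf1).trans v2)
  refine ⟨?_, hfst.trans (by gcongr), ?_, ?_⟩
  · simp only [norm_mul]
    nlinarith [norm_nonneg (f θ), norm_nonneg (g θ), mul_nonneg (norm_nonneg (f θ)) (sub_nonneg.2 hg1),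
      mul_nonneg (norm_nonneg (g θ)) (sub_nonneg.2 hf1)]
  · refine (norm_add_le _ _).trans ?_
    rw [norm_mul, norm_mul]
    calc ‖f1 θ‖ * ‖g θ‖ + ‖f θ‖ * ‖g1 θ‖ ≤ C * ψ1 θ + C * φ1 θ :=
          add_le_add ((mul_le_of_le_one_right (norm_nonneg _) hg1).trans u3)
            ((mul_le_of_le_one_left (norm_nonneg _) hf1).trans v3)
      _ = C * (ψ1 θ + φ1 θ) := by ring
      _ ≤ _ := by gcongr
  · have hcross : ‖(θ : ℂ) * f1 θ‖ * ‖g1 θ‖ ≤ C ^ 2 / c * φ1 θ := by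
      calc ‖(θ : ℂ) * f1 θ‖ * ‖g1 θ‖ ≤ (C * (1 / c)) * (C * φ1 θ) := by
            gcongr
            exact u2.trans (by gcongr)
        _ = C ^ 2 / c * φ1 θ := by ring
    rw [show (θ : ℂ) * (f2 θ * g θ + f1 θ * g1 θ + (f1 θ * g1 θ + f θ * g2 θ)) =
      (θ * f2 θ) * g θ + (θ * f1 θ) * g1 θ + ((θ * f1 θ) * g1 θ + f θ * (θ * g2 θ)) by ring]
    refine (norm_add_le _ _).trans ((add_le_add (norm_add_le _ _) (norm_add_le _ _)).trans ?_)
    rw [norm_mul (_ * _) (g θ), norm_mul (_ * _) (g1 θ), norm_mul (f θ) (_ * _)]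
    have t1 := (mul_le_of_le_one_right (norm_nonneg _) hg1).trans u4
    have t2 := (mul_le_of_le_one_left (norm_nonneg _) hf1).trans v4
    have : 0 ≤ 2 * C ^ 2 / c * ψ1 θ := by positivity
    calc _ ≤ C * ψ1 θ + C ^ 2 / c * φ1 θ + (C ^ 2 / c * φ1 θ + C * φ1 θ) := by
          exact add_le_add (add_le_add t1 hcross) (add_le_add hcross t2)
      _ = C * (ψ1 θ + φ1 θ) + 2 * C ^ 2 / c * φ1 θ := by ring
      _ ≤ (C + 2 * C ^ 2 / c) * (ψ1 θ + φ1 θ) := by linarith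

theorem stableByConvolution_classH : StableByConvolution classH := by
  intro μ hμ ν hν
  obtain ⟨hp, hf, f1, f2, ψ, ψ1, c, C, hc, hC, hf1, hf2, heven, hcont, h0, hψ, hψ1, h⟩ :=
    exists_majorizedBy_of_mem_classH hμ
  obtain ⟨hq, hg, g1, g2, φ, φ1, d, D, hd, hD, hg1, hg2, heven', hcont', h0', hφ, hφ1, h'⟩ :=
    exists_majorizedBy_of_mem_classH hν
  have e : fourierZ (Measure.conv μ ν) = fun θ => fourierZ μ θ * fourierZ ν θ := by
    ext θ; exact fourierZ_conv μ ν θ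
  have hm := MajorizedBy.mul (lt_min hc hd) (lt_max_of_lt_left hC)
    (h.mono hC (min_le_left c d) (le_max_left C D))
    (h'.mono hD (min_le_right c d) (le_max_right C D))
  have hc' : 0 < min c d := lt_min hc hd
  have hC' : 0 < max C D := lt_max_of_lt_left hC
  refine mem_classH_of_majorizedBy (half_pos hc') (by positivity) ?_ ?_ ?_ ?_
    (hcont.add hcont') ?_ (hψ.add hφ) (fun θ hθ => (hψ1 θ hθ).add (hφ1 θ hθ)) (e ▸ hm)
  · rw [e]; exact hf.mul hg
  · rw [e]; exact fun θ hθ => (hf1 θ hθ).mul (hg1 θ hθ)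
  · exact fun θ hθ => ((hf2 θ hθ).mul (hg1 θ hθ)).add ((hf1 θ hθ).mul (hg2 θ hθ))
  · intro θ hθ; simp only [Pi.add_apply, heven θ hθ, heven' θ hθ]
  · simp [h0, h0']

/-! ### Dyadic stopping intervals and the Calderón–Zygmund decomposition. -/

/-- The left endpoint of the dyadic interval of length `2^j` that contains `k`. -/
def dyadicLeft (j : ℕ) (k : ℤ) : ℤ := 2 ^ j * (k / 2 ^ j)

/-- The dyadic interval of length `2^j` that contains `k`. -/
def dyadicCell (j : ℕ) (k : ℤ) : Finset ℤ := Finset.Ico (dyadicLeft j k) (dyadicLeft j k + 2 ^ j)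

theorem mem_dyadicCell {j : ℕ} {k l : ℤ} : l ∈ dyadicCell j k ↔ l / 2 ^ j = k / 2 ^ j := by
  have h2 : (0 : ℤ) < 2 ^ j := by positivity
  rw [dyadicCell, dyadicLeft, Finset.mem_Ico, Int.ediv_eq_iff_of_pos h2]
  constructor <;> rintro ⟨h, h'⟩ <;> constructor <;> linarith

theorem card_dyadicCell (j : ℕ) (k : ℤ) : (dyadicCell j k).card = 2 ^ j := by
  rw [dyadicCell, Int.card_Ico]
  simp only [add_sub_cancel_left]
  exact_mod_cast Int.toNat_natCast (2 ^ j)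

theorem self_mem_dyadicCell (j : ℕ) (k : ℤ) : k ∈ dyadicCell j k := mem_dyadicCell.2 rfl

theorem dyadicCell_eq_of_mem {i j : ℕ} (hij : i ≤ j) {k l : ℤ} (h : l ∈ dyadicCell i k) :
    dyadicCell j l = dyadicCell j k := by
  obtain ⟨d, rfl⟩ := Nat.exists_eq_add_of_le hij
  have e : ∀ x : ℤ, x / 2 ^ (i + d) = x / 2 ^ i / 2 ^ d := fun x => by
    rw [pow_add, Int.ediv_ediv_of_nonneg (by positivity)]
  simp only [dyadicCell, dyadicLeft, e, mem_dyadicCell.1 h]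

theorem dyadicLeft_eq_of_mem {j : ℕ} {k l : ℤ} (h : l ∈ dyadicCell j k) :
    dyadicLeft j l = dyadicLeft j k := by
  simp only [dyadicLeft, mem_dyadicCell.1 h]

theorem dyadicCell_subset_succ (j : ℕ) (k : ℤ) : dyadicCell j k ⊆ dyadicCell (j + 1) k := by
  intro l hl
  rw [← dyadicCell_eq_of_mem j.le_succ hl]
  exact self_mem_dyadicCell _ _

/-- The average of `|f|` on the dyadic interval of length `2^j` that contains `k`. -/
def dyadicAvg (f : ℤ → ℂ) (j : ℕ) (k : ℤ) : ℝ≥0∞ := (2 ^ j)⁻¹ * ∑ l ∈ dyadicCell j k, ‖f l‖ₑ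

/-- The largest `j` such that the average of `|f|` on the dyadic interval of length `2^j` that
contains `k` exceeds `α`. -/
def stopLevel (f : ℤ → ℂ) (α : ℝ≥0∞) (k : ℤ) : ℕ := sSup {j | α < dyadicAvg f j k}

theorem dyadicAvg_le (f : ℤ → ℂ) (j : ℕ) (k : ℤ) : dyadicAvg f j k ≤ (2 ^ j)⁻¹ * l1norm f := by
  rw [dyadicAvg, l1norm_eq_tsum]
  gcongr
  exact ENNReal.sum_le_tsum _

/-- Averages over intervals of length 2^j are at most 2^{-j}‖f‖₁, hence fall below α for large j. So
a largest level exists. -/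
theorem bddAbove_stop {f : ℤ → ℂ} (hf : l1norm f < ∞) {α : ℝ≥0∞} (hα : α ≠ 0) (k : ℤ) :
    BddAbove {j | α < dyadicAvg f j k} := by
  have hlim : l1norm f / α < ∞ := ENNReal.div_lt_top hf.ne hα
  obtain ⟨N, hN⟩ := ENNReal.exists_nat_gt hlim.ne
  refine ⟨N, fun j hj => ?_⟩
  by_contra! hlt
  have h1 : α < (2 ^ j)⁻¹ * l1norm f := lt_of_lt_of_le hj (dyadicAvg_le f j k)
  have h2 : l1norm f ≤ 2 ^ j * α := by
    have : l1norm f / α ≤ 2 ^ j := by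
      refine hN.le.trans ?_
      exact_mod_cast (hlt.le.trans Nat.lt_two_pow_self.le)
    rwa [ENNReal.div_le_iff_le_mul (Or.inl hα) (Or.inr (by simp))] at this
  have h3 : (2 ^ j)⁻¹ * l1norm f ≤ (2 ^ j)⁻¹ * (2 ^ j * α) := by gcongr
  rw [← mul_assoc, ENNReal.inv_mul_cancel (by simp) (by simp), one_mul] at h3
  exact absurd (h1.trans_le h3) (lt_irrefl _)

section Stopping

variable {f : ℤ → ℂ} {α : ℝ≥0∞}

theorem dyadicAvg_le_of_stopLevel_lt (hf : l1norm f < ∞) (hα : α ≠ 0) {j : ℕ} {k : ℤ}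
    (h : stopLevel f α k < j) : dyadicAvg f j k ≤ α := by
  by_contra! hlt
  exact absurd (le_csSup (bddAbove_stop hf hα k) hlt) (not_le.2 h)

/-- Level 0 is excluded because `sSup ∅ = 0` also assigns it to points where no average exceeds α.
The ambiguity is harmless: the stopping interval is then {k} in either case, and f equals its
average there. -/
theorem lt_dyadicAvg_stopLevel (hf : l1norm f < ∞) (hα : α ≠ 0) {k : ℤ}
    (h : stopLevel f α k ≠ 0) : α < dyadicAvg f (stopLevel f α k) k := by
  have hne : {j | α < dyadicAvg f j k}.Nonempty := by
    by_contra hne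
    rw [Set.not_nonempty_iff_eq_empty] at hne
    exact h (by rw [stopLevel, hne]; simp)
  exact Nat.sSup_mem hne (bddAbove_stop hf hα k)

/-- The stopping interval that contains `k`. -/
def stopCell (f : ℤ → ℂ) (α : ℝ≥0∞) (k : ℤ) : Finset ℤ := dyadicCell (stopLevel f α k) k

/-- The left endpoint of the stopping interval that contains `k`. -/
def stopLeft (f : ℤ → ℂ) (α : ℝ≥0∞) (k : ℤ) : ℤ := dyadicLeft (stopLevel f α k) k

/-- From the stopping level of k upwards, the dyadic intervals around k and l coincide, so the
averages that decide the two levels agree. Hence the stopping intervals partition ℤ. -/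
theorem stopLevel_eq_of_mem (hf : l1norm f < ∞) (hα : α ≠ 0) {k l : ℤ}
    (h : l ∈ stopCell f α k) : stopLevel f α l = stopLevel f α k := by
  have e : ∀ j, stopLevel f α k ≤ j → dyadicAvg f j l = dyadicAvg f j k := fun j hj => by
    rw [dyadicAvg, dyadicAvg, dyadicCell_eq_of_mem hj h]
  apply le_antisymm
  · by_contra! hlt
    have h1 := lt_dyadicAvg_stopLevel hf hα (k := l) (by omega)
    rw [e _ hlt.le] at h1
    exact absurd (dyadicAvg_le_of_stopLevel_lt hf hα hlt) (not_le.2 h1)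
  · rcases Nat.eq_zero_or_pos (stopLevel f α k) with h0 | h0
    · omega
    · have h1 := lt_dyadicAvg_stopLevel hf hα h0.ne'
      rw [← e _ le_rfl] at h1
      exact le_csSup (bddAbove_stop hf hα l) h1

theorem mem_stopCell_comm (hf : l1norm f < ∞) (hα : α ≠ 0) {k l : ℤ} :
    l ∈ stopCell f α k ↔ k ∈ stopCell f α l := by
  have : ∀ {k l : ℤ}, l ∈ stopCell f α k → k ∈ stopCell f α l := fun {k l} h => by
    rw [stopCell, stopLevel_eq_of_mem hf hα h, mem_dyadicCell]
    exact (mem_dyadicCell.1 h).symm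
  exact ⟨this, this⟩

theorem stopLeft_eq_of_mem (hf : l1norm f < ∞) (hα : α ≠ 0) {k l : ℤ}
    (h : l ∈ stopCell f α k) : stopLeft f α l = stopLeft f α k := by
  rw [stopLeft, stopLeft, stopLevel_eq_of_mem hf hα h, dyadicLeft_eq_of_mem h]

/-- The averaging kernel of the stopping intervals. -/
def stopWeight (f : ℤ → ℂ) (α : ℝ≥0∞) (k l : ℤ) : ℝ≥0∞ :=
  if l ∈ stopCell f α k then (2 ^ stopLevel f α k)⁻¹ else 0

theorem stopWeight_comm (hf : l1norm f < ∞) (hα : α ≠ 0) (k l : ℤ) :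
    stopWeight f α k l = stopWeight f α l k := by
  simp only [stopWeight]
  by_cases h : l ∈ stopCell f α k
  · rw [if_pos h, if_pos ((mem_stopCell_comm hf hα).1 h), stopLevel_eq_of_mem hf hα h]
  · rw [if_neg h, if_neg (mt (mem_stopCell_comm hf hα).2 h)]

theorem tsum_stopWeight_mul (k : ℤ) (F : ℤ → ℝ≥0∞) :
    ∑' l, stopWeight f α k l * F l = (2 ^ stopLevel f α k)⁻¹ * ∑ l ∈ stopCell f α k, F l := by
  rw [tsum_eq_sum (s := stopCell f α k) (fun l hl => by simp [stopWeight, hl]), Finset.mul_sum]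
  exact Finset.sum_congr rfl fun l hl => by simp [stopWeight, hl]

theorem tsum_stopWeight (k : ℤ) : ∑' l, stopWeight f α k l = 1 := by
  have h := tsum_stopWeight_mul (f := f) (α := α) k (fun _ => 1)
  simp only [mul_one, Finset.sum_const, stopCell, card_dyadicCell, nsmul_eq_mul] at h
  rw [h]
  push_cast
  exact ENNReal.inv_mul_cancel (by simp) (by simp)

/-- The averaging kernel is symmetric with rows of sum 1, hence also columns of sum 1, so averaging
preserves total mass. This replaces any enumeration of the stopping intervals. -/
theorem tsum_tsum_stopWeight_mul (hf : l1norm f < ∞) (hα : α ≠ 0) (F : ℤ → ℝ≥0∞) :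
    ∑' k, ∑' l, stopWeight f α k l * F l = ∑' l, F l := by
  rw [ENNReal.tsum_comm]
  refine tsum_congr fun l => ?_
  rw [ENNReal.tsum_mul_right]
  simp only [stopWeight_comm hf hα _ l, tsum_stopWeight, one_mul]

/-- The conditional expectation of `f` with respect to the partition into stopping intervals. -/
def goodPart (f : ℤ → ℂ) (α : ℝ≥0∞) (k : ℤ) : ℂ :=
  (2 ^ stopLevel f α k)⁻¹ * ∑ l ∈ stopCell f α k, f l

theorem enorm_two_pow_inv (j : ℕ) : ‖((2 : ℂ) ^ j)⁻¹‖ₑ = (2 ^ j)⁻¹ := by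
  rw [enorm_inv (by simp), enorm_pow]
  congr 2
  rw [← ofReal_norm]; simp

theorem enorm_goodPart_le_dyadicAvg (k : ℤ) :
    ‖goodPart f α k‖ₑ ≤ dyadicAvg f (stopLevel f α k) k := by
  rw [goodPart, enorm_mul, enorm_two_pow_inv, dyadicAvg]
  gcongr
  exact enorm_sum_le _ _

/-- The dyadic parent of a stopping interval has average at most α and is twice as long. -/
theorem enorm_goodPart_le (hf : l1norm f < ∞) (hα : α ≠ 0) (k : ℤ) :
    ‖goodPart f α k‖ₑ ≤ 2 * α := by
  refine (enorm_goodPart_le_dyadicAvg k).trans ?_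
  have h1 := dyadicAvg_le_of_stopLevel_lt hf hα (Nat.lt_succ_self (stopLevel f α k))
  refine le_trans ?_ (mul_le_mul_right h1 2)
  rw [dyadicAvg, dyadicAvg, Nat.succ_eq_add_one, pow_succ', ENNReal.mul_inv (by simp) (by simp),
    ← mul_assoc, ← mul_assoc, ENNReal.mul_inv_cancel (by simp) (by simp), one_mul]
  gcongr
  exact dyadicCell_subset_succ _ _

theorem tsum_dyadicAvg_stopLevel (hf : l1norm f < ∞) (hα : α ≠ 0) :
    ∑' k, dyadicAvg f (stopLevel f α k) k = l1norm f := by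
  rw [l1norm_eq_tsum, ← tsum_tsum_stopWeight_mul hf hα (fun l => ‖f l‖ₑ)]
  exact tsum_congr fun k => (tsum_stopWeight_mul k _).symm

theorem l1norm_goodPart_le (hf : l1norm f < ∞) (hα : α ≠ 0) :
    l1norm (goodPart f α) ≤ l1norm f := by
  rw [l1norm_eq_tsum]
  exact (ENNReal.tsum_le_tsum fun k => enorm_goodPart_le_dyadicAvg k).trans
    (tsum_dyadicAvg_stopLevel hf hα).le

theorem summable_of_tsum_enorm_ne_top {ι : Type*} {u : ι → ℂ} (h : ∑' i, ‖u i‖ₑ ≠ ∞) :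
    Summable u := by
  rw [← summable_norm_iff]
  simp only [enorm_eq_nnnorm] at h
  rw [ENNReal.tsum_coe_ne_top_iff_summable, ← NNReal.summable_coe] at h
  exact h

/-- Cancellation of the bad part: averaging is self-adjoint and fixes functions that are constant on
stopping intervals, such as any function of the left endpoint. -/
theorem tsum_mul_goodPart (hf : l1norm f < ∞) (hα : α ≠ 0) {Φ : ℤ → ℂ} {B : ℝ≥0∞} (hB : B ≠ ∞)
    (hΦ : ∀ k, ‖Φ k‖ₑ ≤ B) :
    ∑' k, Φ (stopLeft f α k) * goodPart f α k = ∑' k, Φ (stopLeft f α k) * f k := by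
  let w : ℤ → ℤ → ℂ := fun k l => if l ∈ stopCell f α k then ((2 : ℂ) ^ stopLevel f α k)⁻¹ else 0
  have hw : ∀ k l, ‖w k l‖ₑ = stopWeight f α k l := fun k l => by
    simp only [w, stopWeight]
    split_ifs
    · exact enorm_two_pow_inv _
    · simp
  have hs : Summable (Function.uncurry fun l k => Φ (stopLeft f α k) * (w k l * f l)) := by
    apply summable_of_tsum_enorm_ne_top
    rw [ENNReal.tsum_prod' (f := fun p : ℤ × ℤ => ‖Function.uncurry _ p‖ₑ), ENNReal.tsum_comm]
    refine ne_top_of_le_ne_top (ENNReal.mul_ne_top hB hf.ne) ?_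
    rw [l1norm_eq_tsum, ← tsum_tsum_stopWeight_mul hf hα (fun l => ‖f l‖ₑ),
      ← ENNReal.tsum_mul_left]
    refine ENNReal.tsum_le_tsum fun k => ?_
    rw [← ENNReal.tsum_mul_left]
    refine ENNReal.tsum_le_tsum fun l => ?_
    simp only [Function.uncurry_apply_pair, enorm_mul, hw]
    gcongr
    exact hΦ _
  calc ∑' k, Φ (stopLeft f α k) * goodPart f α k
      = ∑' k, ∑' l, Φ (stopLeft f α k) * (w k l * f l) := by
        refine tsum_congr fun k => ?_
        rw [tsum_mul_left, goodPart, tsum_eq_sum (s := stopCell f α k)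
          (fun l hl => by simp [w, hl]), Finset.mul_sum]
        congr 1
        exact Finset.sum_congr rfl fun l hl => by simp [w, hl]
    _ = ∑' l, ∑' k, Φ (stopLeft f α k) * (w k l * f l) := hs.tsum_comm
    _ = ∑' l, Φ (stopLeft f α l) * f l := by
        refine tsum_congr fun l => ?_
        have e : ∀ k, Φ (stopLeft f α k) * (w k l * f l) = w l k * (Φ (stopLeft f α l) * f l) := by
          intro k
          simp only [w]
          by_cases h : l ∈ stopCell f α k
          · rw [if_pos h, if_pos ((mem_stopCell_comm hf hα).1 h), stopLevel_eq_of_mem hf hα h,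
              stopLeft_eq_of_mem hf hα h]
            ring
          · rw [if_neg h, if_neg (mt (mem_stopCell_comm hf hα).2 h)]
            simp
        have e1 : ∑' k, w l k = 1 := by
          rw [tsum_eq_sum (s := stopCell f α l) (fun k hk => by simp [w, hk]),
            Finset.sum_congr rfl (fun k hk =>
              show w l k = ((2 : ℂ) ^ stopLevel f α l)⁻¹ by simp only [w, if_pos hk]), Finset.sum_const,
            stopCell, card_dyadicCell, nsmul_eq_mul]
          push_cast
          exact mul_inv_cancel₀ (by simp)
        rw [tsum_congr e, tsum_mul_right, e1, one_mul]

/-- The union of the enlarged nontrivial stopping intervals. -/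
def exceptionalSet (f : ℤ → ℂ) (α : ℝ≥0∞) : Set ℤ :=
  {x | ∃ k, stopLevel f α k ≠ 0 ∧ |x - stopLeft f α k| < 2 * 2 ^ stopLevel f α k}

theorem encard_eq_tsum (s : Set ℤ) : (s.encard : ℝ≥0∞) = ∑' x, s.indicator (fun _ => 1) x := by
  rw [← ENNReal.tsum_set_one, tsum_subtype s (fun _ => (1 : ℝ≥0∞))]

/-- Each stopping interval is counted once by giving each of its points the weight 1/length. An
enlarged interval has at most 4 times the length, and α is less than the average of |f| over the
original, so the total is at most 4‖f‖₁. -/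
theorem mul_encard_exceptionalSet_le (hf : l1norm f < ∞) (hα : α ≠ 0) :
    α * (exceptionalSet f α).encard ≤ 4 * l1norm f := by
  classical
  let N : ℤ → Set ℤ := fun k =>
    {x | stopLevel f α k ≠ 0 ∧ |x - stopLeft f α k| < 2 * 2 ^ stopLevel f α k}
  have hcover : ∀ x, (exceptionalSet f α).indicator (fun _ => 1) x ≤
      ∑' k, (2 ^ stopLevel f α k)⁻¹ * (N k).indicator (fun _ => (1 : ℝ≥0∞)) x := by
    intro x
    by_cases hx : x ∈ exceptionalSet f α
    · obtain ⟨k₀, hk₀⟩ := hx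
      rw [Set.indicator_of_mem (show x ∈ exceptionalSet f α from ⟨k₀, hk₀⟩),
        ← tsum_stopWeight (f := f) (α := α) k₀]
      refine ENNReal.tsum_le_tsum fun k => ?_
      rw [stopWeight]
      split_ifs with hk
      · have hxk : x ∈ N k := by
          change _ ∧ _
          rwa [stopLevel_eq_of_mem hf hα hk, stopLeft_eq_of_mem hf hα hk]
        rw [Set.indicator_of_mem hxk, tsum_stopWeight, mul_one, stopLevel_eq_of_mem hf hα hk]
      · exact zero_le
    · rw [Set.indicator_of_notMem hx]; exact zero_le
  have hN : ∀ k, α * ((2 ^ stopLevel f α k)⁻¹ * ∑' x, (N k).indicator (fun _ => (1 : ℝ≥0∞)) x) ≤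
      4 * dyadicAvg f (stopLevel f α k) k := by
    intro k
    by_cases hk : stopLevel f α k = 0
    · have : N k = ∅ := by ext x; simp [N, hk]
      simp [this]
    · set J := stopLevel f α k
      set c := stopLeft f α k
      have hsub : N k ⊆ ↑(Finset.Ico (c - 2 * 2 ^ J) (c + 2 * 2 ^ J)) := by
        rintro x ⟨-, hx⟩
        rw [abs_lt] at hx
        simp only [Finset.coe_Ico, Set.mem_Ico]
        constructor <;> linarith [hx.1, hx.2]
      have hcard : (∑' x, (N k).indicator (fun _ => (1 : ℝ≥0∞)) x) ≤ 4 * 2 ^ J := by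
        rw [← encard_eq_tsum]
        have h1 := Set.encard_le_encard hsub
        rw [Set.encard_coe_eq_coe_finsetCard, Int.card_Ico,
          show c + 2 * 2 ^ J - (c - 2 * 2 ^ J) = ((4 * 2 ^ J : ℕ) : ℤ) by push_cast; ring,
          Int.toNat_natCast] at h1
        refine (ENat.toENNReal_le.2 h1).trans (le_of_eq ?_)
        simp
      calc α * ((2 ^ J)⁻¹ * ∑' x, (N k).indicator (fun _ => (1 : ℝ≥0∞)) x)
          ≤ dyadicAvg f J k * ((2 ^ J)⁻¹ * (4 * 2 ^ J)) := by
            gcongr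
            exact (lt_dyadicAvg_stopLevel hf hα hk).le
        _ = 4 * dyadicAvg f J k := by
            rw [mul_left_comm _ 4, ENNReal.inv_mul_cancel (by simp) (by simp), mul_one, mul_comm]
  calc α * (exceptionalSet f α).encard
      ≤ α * ∑' x, ∑' k, (2 ^ stopLevel f α k)⁻¹ * (N k).indicator (fun _ => (1 : ℝ≥0∞)) x := by
        rw [encard_eq_tsum]
        gcongr
        exact hcover _
    _ = ∑' k, α * ((2 ^ stopLevel f α k)⁻¹ * ∑' x, (N k).indicator (fun _ => (1 : ℝ≥0∞)) x) := by
        rw [ENNReal.tsum_comm, ← ENNReal.tsum_mul_left]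
        simp only [ENNReal.tsum_mul_left]
    _ ≤ ∑' k, 4 * dyadicAvg f (stopLevel f α k) k := ENNReal.tsum_le_tsum hN
    _ = 4 * l1norm f := by rw [ENNReal.tsum_mul_left, tsum_dyadicAvg_stopLevel hf hα]

end Stopping

/-! ### Weak type (1,1) for maximal operators from a Hörmander condition. -/

theorem conv_eq_tsum_sub (a b : ℤ → ℂ) (x : ℤ) : conv a b x = ∑' k, a (x - k) * b k := by
  rw [conv, ← (Equiv.subLeft x).tsum_eq]
  simp

theorem enorm_le_l1norm (a : ℤ → ℂ) (k : ℤ) : ‖a k‖ₑ ≤ l1norm a := by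
  rw [l1norm_eq_tsum]
  exact ENNReal.le_tsum k

theorem summable_mul_of_enorm_le {u v : ℤ → ℂ} {B : ℝ≥0∞} (hB : B ≠ ∞) (hu : ∀ k, ‖u k‖ₑ ≤ B)
    (hv : l1norm v < ∞) : Summable fun k => u k * v k := by
  apply summable_of_tsum_enorm_ne_top
  refine ne_top_of_le_ne_top (ENNReal.mul_ne_top hB hv.ne) ?_
  rw [l1norm_eq_tsum, ← ENNReal.tsum_mul_left]
  refine ENNReal.tsum_le_tsum fun k => ?_
  rw [enorm_mul]
  gcongr
  exact hu k

/-- The maximal operator of a family of kernels that is bounded in `ℓ¹(ℤ)` and satisfies a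
Hörmander condition is of weak type `(1,1)`. -/
theorem weak_type_of_hormander {ι : Type*} {K : ι → ℤ → ℂ} {A D : ℝ≥0∞} (hA : A < ∞)
    (hA0 : A ≠ 0) (hK : ∀ i, l1norm (K i) ≤ A)
    (hD : ∀ (j : ℕ) (y : ℤ), 0 ≤ y → y < 2 ^ j →
      ∑' x, {x : ℤ | 2 * 2 ^ j ≤ |x|}.indicator (fun x => ⨆ i, ‖K i (x - y) - K i x‖ₑ) x ≤ D)
    {f : ℤ → ℂ} (hf : l1norm f < ∞) {t : ℝ≥0∞} (ht : t ≠ 0) :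
    t * ({k : ℤ | t < ⨆ i, ‖conv (K i) f k‖ₑ}.encard : ℝ≥0∞) ≤ (16 * A + 4 * D) * l1norm f := by
  -- With |g| ≤ 2α and ‖K_i‖₁ ≤ A, this height makes |K_i * g| ≤ 2αA = t/2.
  set α := t / (4 * A) with hαdef
  have h4A : 4 * A ≠ ∞ := ENNReal.mul_ne_top (by simp) hA.ne
  have h4A0 : 4 * A ≠ 0 := by simp [hA0]
  have hα : α ≠ 0 := (ENNReal.div_pos ht h4A).ne'
  have hαt : 4 * A * α = t := ENNReal.mul_div_cancel h4A0 h4A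
  set g := goodPart f α
  set c := stopLeft f α
  set J := stopLevel f α
  have hg : l1norm g < ∞ := (l1norm_goodPart_le hf hα).trans_lt hf
  have hb : l1norm (f - g) ≤ 2 * l1norm f := by
    rw [two_mul]
    exact (l1norm_sub_le f g).trans (by gcongr; exact l1norm_goodPart_le hf hα)
  set Ω := exceptionalSet f α
  let S : ℤ → ℤ → ℝ≥0∞ := fun x k => ⨆ i, ‖K i (x - k) - K i (x - c k)‖ₑ
  let B : ℤ → ℝ≥0∞ := fun x => ∑' k, S x k * ‖(f - g) k‖ₑ
  have hgood : ∀ i x, ‖conv (K i) g x‖ₑ ≤ t / 2 := by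
    intro i x
    have e : t / 2 = A * (2 * α) := by
      rw [← hαt, show 4 * A * α = A * (2 * α) * 2 by ring]
      exact ENNReal.mul_div_cancel_right (by simp) (by simp)
    rw [e]
    calc ‖conv (K i) g x‖ₑ ≤ ∑' j, ‖K i j * g (x - j)‖ₑ := enorm_tsum_le_tsum_enorm
      _ ≤ ∑' j, ‖K i j‖ₑ * (2 * α) := by
        refine ENNReal.tsum_le_tsum fun j => ?_
        rw [enorm_mul]
        gcongr
        exact enorm_goodPart_le hf hα _
      _ ≤ A * (2 * α) := by
        rw [ENNReal.tsum_mul_right, ← l1norm_eq_tsum]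
        gcongr
        exact hK i
  have hbad : ∀ i x, ‖conv (K i) (f - g) x‖ₑ ≤ B x := by
    intro i x
    have hKb : ∀ k, ‖K i k‖ₑ ≤ A := fun k => (enorm_le_l1norm _ k).trans (hK i)
    have hbf : l1norm (f - g) < ∞ := hb.trans_lt (ENNReal.mul_lt_top (by simp) hf)
    -- For fixed x, the factor K_i(x - c k) depends on k only through its stopping interval, so f -
    -- g sums to zero against it and it may be subtracted from the kernel.
    have hz : ∑' k, K i (x - c k) * (f - g) k = 0 := by
      have s1 := summable_mul_of_enorm_le hA.ne (fun k => hKb (x - c k)) hf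
      have s2 := summable_mul_of_enorm_le hA.ne (fun k => hKb (x - c k)) hg
      simp only [Pi.sub_apply, mul_sub]
      rw [s1.tsum_sub s2, tsum_mul_goodPart hf hα (Φ := fun k => K i (x - k)) hA.ne
        (fun k => hKb _), sub_self]
    have e : conv (K i) (f - g) x = ∑' k, (K i (x - k) - K i (x - c k)) * (f - g) k := by
      have s1 := summable_mul_of_enorm_le hA.ne (fun k => hKb (x - k)) hbf
      have s2 := summable_mul_of_enorm_le hA.ne (fun k => hKb (x - c k)) hbf
      simp only [sub_mul]
      rw [s1.tsum_sub s2, hz, sub_zero, conv_eq_tsum_sub]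
    rw [e]
    refine enorm_tsum_le_tsum_enorm.trans (ENNReal.tsum_le_tsum fun k => ?_)
    rw [enorm_mul]
    gcongr
    exact le_iSup (fun i => ‖K i (x - k) - K i (x - c k)‖ₑ) i
  have hsub : {k : ℤ | t < ⨆ i, ‖conv (K i) f k‖ₑ} ⊆ Ω ∪ {x | x ∉ Ω ∧ t / 2 < B x} := by
    intro x hx
    by_cases hxΩ : x ∈ Ω
    · exact Or.inl hxΩ
    refine Or.inr ⟨hxΩ, ?_⟩
    obtain ⟨i, hi⟩ := lt_iSup_iff.1 (show t < ⨆ i, ‖conv (K i) f x‖ₑ from hx)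
    by_contra! hle
    have e : conv (K i) f x = conv (K i) g x + conv (K i) (f - g) x := by
      have hKb : ∀ k, ‖K i k‖ₑ ≤ A := fun k => (enorm_le_l1norm _ k).trans (hK i)
      have s1 := summable_mul_of_enorm_le hA.ne (fun k => hKb (x - k)) hf
      have s2 := summable_mul_of_enorm_le hA.ne (fun k => hKb (x - k)) hg
      simp only [conv_eq_tsum_sub, Pi.sub_apply, mul_sub]
      rw [s1.tsum_sub s2, add_sub_cancel]
    have : ‖conv (K i) f x‖ₑ ≤ t / 2 + t / 2 := by
      rw [e]
      exact (enorm_add_le _ _).trans (add_le_add (hgood i x) ((hbad i x).trans hle))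
    rw [ENNReal.add_halves] at this
    exact absurd hi (not_lt.2 this)
  -- Off the exceptional set |x - c k| ≥ 2·2^J, and 0 ≤ k - c k < 2^J, which is the Hörmander range
  -- centred at c k. For level 0 the sum vanishes because c k = k.
  have hcol : ∀ k, ∑' x, Ωᶜ.indicator (fun x => S x k) x ≤ D := by
    intro k
    by_cases hk : J k = 0
    · have hck : c k = k := by
        show dyadicLeft (J k) k = k
        rw [hk]; simp [dyadicLeft]
      simp [S, hck]
    · have hy0 : 0 ≤ k - c k ∧ k - c k < 2 ^ J k := by
        have := Finset.mem_Ico.1 (self_mem_dyadicCell (J k) k)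
        change c k ≤ k ∧ k < c k + 2 ^ J k at this
        constructor <;> linarith [this.1, this.2]
      refine le_trans ?_ (hD (J k) (k - c k) hy0.1 hy0.2)
      rw [← (Equiv.subRight (c k)).tsum_eq ({x : ℤ | 2 * 2 ^ J k ≤ |x|}.indicator _)]
      refine ENNReal.tsum_le_tsum fun x => ?_
      by_cases hx : x ∈ Ω
      · rw [Set.indicator_of_notMem (by simpa using hx)]; exact zero_le
      · have hx' : x - c k ∈ {x : ℤ | 2 * 2 ^ J k ≤ |x|} := by
          change 2 * 2 ^ J k ≤ |x - c k|
          by_contra! hlt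
          exact hx ⟨k, hk, hlt⟩
        simp only [Equiv.subRight_apply]
        rw [Set.indicator_of_mem (by simpa using hx), Set.indicator_of_mem hx']
        simp only [S, le_refl, sub_sub, add_sub_cancel]
  have hcheb : t / 2 * ({x | x ∉ Ω ∧ t / 2 < B x}.encard : ℝ≥0∞) ≤ D * (2 * l1norm f) := by
    rw [encard_eq_tsum, ← ENNReal.tsum_mul_left]
    calc ∑' x, t / 2 * {x | x ∉ Ω ∧ t / 2 < B x}.indicator (fun _ => 1) x
        ≤ ∑' x, ∑' k, Ωᶜ.indicator (fun x => S x k) x * ‖(f - g) k‖ₑ := by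
          refine ENNReal.tsum_le_tsum fun x => ?_
          by_cases hx : x ∉ Ω ∧ t / 2 < B x
          · rw [Set.indicator_of_mem (show x ∈ {x | x ∉ Ω ∧ t / 2 < B x} from hx), mul_one]
            refine hx.2.le.trans (le_of_eq (tsum_congr fun k => ?_))
            rw [Set.indicator_of_mem (by simpa using hx.1)]
          · rw [Set.indicator_of_notMem (show x ∉ {x | x ∉ Ω ∧ t / 2 < B x} from hx), mul_zero]
            exact zero_le
      _ = ∑' k, (∑' x, Ωᶜ.indicator (fun x => S x k) x) * ‖(f - g) k‖ₑ := by
          rw [ENNReal.tsum_comm]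
          simp only [ENNReal.tsum_mul_right]
      _ ≤ ∑' k, D * ‖(f - g) k‖ₑ := by
          refine ENNReal.tsum_le_tsum fun k => ?_
          gcongr
          exact hcol k
      _ ≤ _ := by
          rw [ENNReal.tsum_mul_left, ← l1norm_eq_tsum]
          gcongr
  have hcard : ({k : ℤ | t < ⨆ i, ‖conv (K i) f k‖ₑ}.encard : ℝ≥0∞) ≤
      (Ω.encard : ℝ≥0∞) + ({x | x ∉ Ω ∧ t / 2 < B x}.encard : ℝ≥0∞) := by
    rw [← ENat.toENNReal_add]
    exact ENat.toENNReal_le.2 ((Set.encard_le_encard hsub).trans (Set.encard_union_le _ _))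
  calc t * ({k : ℤ | t < ⨆ i, ‖conv (K i) f k‖ₑ}.encard : ℝ≥0∞)
      ≤ t * (Ω.encard : ℝ≥0∞) + t * ({x | x ∉ Ω ∧ t / 2 < B x}.encard : ℝ≥0∞) := by
        rw [← mul_add]; gcongr
    _ ≤ 4 * A * (4 * l1norm f) + 2 * (D * (2 * l1norm f)) := by
        refine add_le_add ?_ ?_
        · rw [← hαt, mul_assoc (4 * A) α]
          exact mul_le_mul_right (mul_encard_exceptionalSet_le hf hα) _
        · have e : t = 2 * (t / 2) := (ENNReal.mul_div_cancel (by simp) (by simp)).symm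
          nth_rewrite 1 [e]
          rw [mul_assoc]
          gcongr
    _ = _ := by ring

/-! ### The Hörmander condition from first differences of size 1/x². -/

/-- Every point between x - n and x has absolute value at least |x|/2, so each of the n unit steps
costs at most 4D/x². -/
theorem norm_sub_le_of_regular {a : ℤ → ℂ} {D : ℝ} (hD : 0 ≤ D)
    (ha : ∀ x : ℤ, x ≠ 0 → ‖a x - a (x + 1)‖ ≤ D / (x : ℝ) ^ 2) {x : ℤ} {R : ℕ}
    (hx : 2 * (R : ℤ) ≤ |x|) (hx0 : x ≠ 0) (n : ℕ) (hn : n ≤ R) :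
    ‖a (x - n) - a x‖ ≤ n * (4 * D / (x : ℝ) ^ 2) := by
  induction n with
  | zero => simp
  | succ n ih =>
    have h1 := ih (by omega)
    have hxn : |x| ≤ 2 * |x - n - 1| := by
      have : |x| ≤ |x - n - 1| + (n + 1) := by
        have := abs_add_le (x - n - 1) (n + 1)
        rw [show x - n - 1 + (n + 1) = x by ring] at this
        rwa [abs_of_nonneg (by positivity : (0 : ℤ) ≤ n + 1)] at this
      omega
    have hne : x - n - 1 ≠ 0 := by
      intro h
      rw [h] at hxn
      have := abs_pos.2 hx0
      simp at hxn
      exact hx0 hxn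
    have hxR : (x : ℝ) ^ 2 ≤ 4 * ((x - n - 1 : ℤ) : ℝ) ^ 2 := by
      have : x ^ 2 ≤ (2 * (x - n - 1)) ^ 2 := by
        rw [sq_le_sq, abs_mul, abs_two]; exact hxn
      have h' : x ^ 2 ≤ 4 * (x - n - 1) ^ 2 := by linarith
      exact_mod_cast h'
    have hx2 : (0 : ℝ) < (x : ℝ) ^ 2 := by positivity
    have hy2 : (0 : ℝ) < ((x - n - 1 : ℤ) : ℝ) ^ 2 := by
      have : ((x - n - 1 : ℤ) : ℝ) ≠ 0 := by exact_mod_cast hne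
      positivity
    have h2 : ‖a (x - n - 1) - a (x - n)‖ ≤ 4 * D / (x : ℝ) ^ 2 := by
      have := ha (x - n - 1) hne
      rw [show x - n - 1 + 1 = x - n by ring] at this
      refine this.trans ?_
      rw [div_le_div_iff₀ hy2 hx2]
      nlinarith
    have e : a (x - (n + 1 : ℕ)) - a x = (a (x - n - 1) - a (x - n)) + (a (x - n) - a x) := by
      push_cast
      rw [← sub_sub]; ring
    rw [e]
    refine (norm_add_le _ _).trans ((add_le_add h2 h1).trans (le_of_eq ?_))
    push_cast; ring

theorem tsum_int_natAbs_le (F : ℕ → ℝ≥0∞) : ∑' x : ℤ, F x.natAbs ≤ 2 * ∑' n, F n := by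
  have h := HasSum.of_nat_of_neg_add_one (f := fun x : ℤ => F x.natAbs)
    (ENNReal.summable.hasSum (f := fun n : ℕ => F (n : ℤ).natAbs))
    (ENNReal.summable.hasSum (f := fun n : ℕ => F (-((n : ℤ) + 1)).natAbs))
  rw [h.tsum_eq, two_mul]
  refine add_le_add (le_of_eq (by simp)) ?_
  have e : ∀ n : ℕ, (-((n : ℤ) + 1)).natAbs = n + 1 := fun n => by omega
  simp only [e]
  exact ENNReal.tsum_comp_le_tsum_of_injective (add_left_injective 1) F

theorem tsum_inv_sq_tail_le {m : ℕ} (hm : 1 ≤ m) :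
    ∑' n : ℕ, (if m ≤ n then ENNReal.ofReal (((n : ℝ) ^ 2)⁻¹) else 0) ≤ ENNReal.ofReal (2 / m) := by
  refine ENNReal.tsum_le_of_sum_range_le fun N => ?_
  rw [← Finset.sum_filter, ← ENNReal.ofReal_sum_of_nonneg (fun _ _ => by positivity)]
  refine ENNReal.ofReal_le_ofReal ?_
  have hs : (Finset.range N).filter (fun n => m ≤ n) = Finset.Ioo (m - 1) N := by
    ext n; simp only [Finset.mem_filter, Finset.mem_range, Finset.mem_Ioo]; omega
  rw [hs]
  have := sum_Ioo_inv_sq_le (α := ℝ) (m - 1) N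
  rwa [Nat.cast_sub hm, Nat.cast_one, sub_add_cancel] at this

/-- At most 2^j unit steps give a bound 4D·2^j/x², independent of i. Its sum over |x| ≥ 2·2^j is at
most 2·4D·2^j·2/(2·2^j) = 8D. -/
theorem hormander_of_regular {ι : Type*} {K : ι → ℤ → ℂ} {D : ℝ} (hD : 0 ≤ D)
    (hK : ∀ i (x : ℤ), x ≠ 0 → ‖K i x - K i (x + 1)‖ ≤ D / (x : ℝ) ^ 2) (j : ℕ) (y : ℤ)
    (hy : 0 ≤ y) (hy' : y < 2 ^ j) :
    ∑' x, {x : ℤ | 2 * 2 ^ j ≤ |x|}.indicator (fun x => ⨆ i, ‖K i (x - y) - K i x‖ₑ) x ≤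
      ENNReal.ofReal (8 * D) := by
  obtain ⟨n, rfl⟩ := Int.eq_ofNat_of_zero_le hy
  have hn : n < 2 ^ j := by exact_mod_cast hy'
  have hR : (0 : ℝ) < 2 ^ j := by positivity
  let F : ℕ → ℝ≥0∞ := fun k =>
    ENNReal.ofReal (4 * D * 2 ^ j) * if 2 * 2 ^ j ≤ k then ENNReal.ofReal (((k : ℝ) ^ 2)⁻¹) else 0
  calc ∑' x, {x : ℤ | 2 * 2 ^ j ≤ |x|}.indicator (fun x => ⨆ i, ‖K i (x - n) - K i x‖ₑ) x
      ≤ ∑' x : ℤ, F x.natAbs := by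
        refine ENNReal.tsum_le_tsum fun x => ?_
        by_cases hx : 2 * 2 ^ j ≤ |x|
        · have hx' : 2 * 2 ^ j ≤ x.natAbs := by zify; exact hx
          have hx0 : x ≠ 0 := by
            rintro rfl
            have : (0 : ℤ) < 2 * 2 ^ j := by positivity
            simp at hx; omega
          rw [Set.indicator_of_mem (show x ∈ {x : ℤ | 2 * 2 ^ j ≤ |x|} from hx)]
          simp only [F, if_pos hx']
          refine iSup_le fun i => ?_
          rw [← ENNReal.ofReal_mul (by positivity), ← ofReal_norm]
          refine ENNReal.ofReal_le_ofReal ?_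
          refine (norm_sub_le_of_regular (R := 2 ^ j) hD (hK i) (by push_cast; exact hx) hx0 n
            hn.le).trans ?_
          have hsq : ((x.natAbs : ℕ) : ℝ) ^ 2 = (x : ℝ) ^ 2 := by
            rw [Nat.cast_natAbs, Int.cast_abs, sq_abs]
          have hn' : (n : ℝ) ≤ 2 ^ j := by exact_mod_cast hn.le
          rw [hsq, div_eq_mul_inv]
          calc (n : ℝ) * (4 * D * ((x : ℝ) ^ 2)⁻¹) ≤ 2 ^ j * (4 * D * ((x : ℝ) ^ 2)⁻¹) := by gcongr
            _ = _ := by ring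
        · rw [Set.indicator_of_notMem (show x ∉ {x : ℤ | 2 * 2 ^ j ≤ |x|} from hx)]
          exact zero_le
    _ ≤ 2 * ∑' k, F k := tsum_int_natAbs_le F
    _ ≤ 2 * (ENNReal.ofReal (4 * D * 2 ^ j) * ENNReal.ofReal (2 / ((2 * 2 ^ j : ℕ) : ℝ))) := by
        rw [ENNReal.tsum_mul_left]
        gcongr
        exact tsum_inv_sq_tail_le (by have := Nat.one_le_two_pow (n := j); omega)
    _ = ENNReal.ofReal (8 * D) := by
        rw [← ENNReal.ofReal_mul (by positivity), show (2 : ℝ≥0∞) = ENNReal.ofReal 2 by simp,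
          ← ENNReal.ofReal_mul (by norm_num)]
        congr 1
        push_cast
        field_simp
        ring

/-! ### Bounds uniform in n for the symbol and its derivatives. -/

theorem pow_mul_exp_neg_le (b : ℕ) {s : ℝ} (hs : 0 ≤ s) :
    s ^ b * Real.exp (-s) ≤ Real.exp 1 * (b + 2).factorial / (1 + s) ^ 2 := by
  have h := Real.pow_div_factorial_le_exp (1 + s) (by linarith) (b + 2)
  rw [div_le_iff₀ (by positivity), Real.exp_add] at h
  have h1 : s ^ b ≤ (1 + s) ^ b := by gcongr; linarith
  rw [le_div_iff₀ (by positivity), Real.exp_neg, mul_assoc, mul_comm _ ((1 + s) ^ 2), ← mul_assoc,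
    ← div_eq_mul_inv, div_le_iff₀ (Real.exp_pos s)]
  calc s ^ b * (1 + s) ^ 2 ≤ (1 + s) ^ b * (1 + s) ^ 2 := by gcongr
    _ = (1 + s) ^ (b + 2) := (pow_add _ _ _).symm
    _ ≤ _ := by linarith

section Symbol

/-- The monomial `z^a (1 - z)^b`. -/
def bernsteinMonomial (a b : ℕ) (z : ℂ) : ℂ := z ^ a * (1 - z) ^ b

theorem hasDerivAt_bernsteinMonomial (a b : ℕ) (z : ℂ) :
    HasDerivAt (bernsteinMonomial a b)
      (a * bernsteinMonomial (a - 1) b z - b * bernsteinMonomial a (b - 1) z) z := by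
  have h1 := (hasDerivAt_id z).pow a
  have h2 := ((hasDerivAt_const z (1 : ℂ)).sub (hasDerivAt_id z)).pow b
  refine (h1.mul h2).congr_deriv ?_
  simp [bernsteinMonomial]
  ring

/-- The symbol `n^m z^n (1 - z)^m` as a function of `z = μ̂(θ)`. -/
def symbol (m n : ℕ) (z : ℂ) : ℂ := n ^ m * bernsteinMonomial n m z

/-- The derivative of the symbol. -/
def symbolDeriv (m n : ℕ) (z : ℂ) : ℂ :=
  n ^ m * (n * bernsteinMonomial (n - 1) m z - m * bernsteinMonomial n (m - 1) z)

/-- The second derivative of the symbol. -/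
def symbolDeriv2 (m n : ℕ) (z : ℂ) : ℂ :=
  n ^ m * (n * ((n - 1 : ℕ) * bernsteinMonomial (n - 1 - 1) m z -
      m * bernsteinMonomial (n - 1) (m - 1) z) -
    m * (n * bernsteinMonomial (n - 1) (m - 1) z -
      (m - 1 : ℕ) * bernsteinMonomial n (m - 1 - 1) z))

theorem hasDerivAt_symbol (m n : ℕ) (z : ℂ) : HasDerivAt (symbol m n) (symbolDeriv m n z) z :=
  (hasDerivAt_bernsteinMonomial n m z).const_mul _

theorem hasDerivAt_symbolDeriv (m n : ℕ) (z : ℂ) :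
    HasDerivAt (symbolDeriv m n) (symbolDeriv2 m n z) z :=
  (((hasDerivAt_bernsteinMonomial (n - 1) m z).const_mul _).sub
    ((hasDerivAt_bernsteinMonomial n (m - 1) z).const_mul _)).const_mul _

/-- Here |z|^a ≤ e^{-aU}. The slack n ≤ a + 2 admits the exponents n, n - 1 and n - 2 (truncated)
met after two differentiations, at the price of e^{2U} ≤ e². -/
theorem norm_bernsteinMonomial_le {a b n : ℕ} (hn : n ≤ a + 2) {z : ℂ} {U C : ℝ} (hU : 0 ≤ U)
    (hU1 : U ≤ 1) (hz : ‖z‖ ≤ 1 - U) (hz' : ‖1 - z‖ ≤ C * U) :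
    ‖bernsteinMonomial a b z‖ ≤ Real.exp 2 * Real.exp (-(n * U)) * (C * U) ^ b := by
  rw [bernsteinMonomial, norm_mul, norm_pow, norm_pow]
  have h1 : ‖z‖ ^ a ≤ Real.exp 2 * Real.exp (-(n * U)) := by
    calc ‖z‖ ^ a ≤ (Real.exp (-U)) ^ a := by
          gcongr
          exact hz.trans (by linarith [Real.add_one_le_exp (-U)])
      _ = Real.exp (-(a * U)) := by rw [← Real.exp_nat_mul]; congr 1; ring
      _ ≤ Real.exp (2 + -(n * U)) := by
          gcongr
          have : (n : ℝ) ≤ a + 2 := by exact_mod_cast hn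
          nlinarith
      _ = _ := Real.exp_add _ _
  gcongr

theorem pow_mul_norm_bernsteinMonomial_le {a b n : ℕ} (i : ℕ) (hn : n ≤ a + 2) {z : ℂ} {U C : ℝ}
    (hU : 0 ≤ U) (hU1 : U ≤ 1) (hC : 0 ≤ C) (hz : ‖z‖ ≤ 1 - U) (hz' : ‖1 - z‖ ≤ C * U) :
    (n : ℝ) ^ (b + i) * (U ^ i * ‖bernsteinMonomial a b z‖) ≤
      Real.exp 3 * C ^ b * (b + i + 2).factorial / (1 + n * U) ^ 2 := by
  calc (n : ℝ) ^ (b + i) * (U ^ i * ‖bernsteinMonomial a b z‖)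
      ≤ (n : ℝ) ^ (b + i) * (U ^ i * (Real.exp 2 * Real.exp (-(n * U)) * (C * U) ^ b)) := by
        gcongr
        exact norm_bernsteinMonomial_le hn hU hU1 hz hz'
    _ = Real.exp 2 * C ^ b * ((n * U) ^ (b + i) * Real.exp (-(n * U))) := by ring
    _ ≤ Real.exp 2 * C ^ b * (Real.exp 1 * (b + i + 2).factorial / (1 + n * U) ^ 2) := by
        gcongr
        exact pow_mul_exp_neg_le (b + i) (by positivity)
    _ = _ := by
        rw [show (3 : ℝ) = 2 + 1 by norm_num, Real.exp_add]; ring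

/-- Pairing n^m with the factor (CU)^m from |1 - z|^m yields powers of nU against e^{-nU}, which
leave (1 + nU)^{-2} to spare. A derivative produces n or removes one factor 1 - z, so in either case
one n is unpaired. In the second derivative two are unpaired, and the weight U pairs with one of
them. -/
theorem exists_symbol_bounds (m : ℕ) {C : ℝ} (hC : 0 ≤ C) :
    ∃ M : ℝ, 0 ≤ M ∧ ∀ (n : ℕ) (z : ℂ) (U : ℝ), 0 ≤ U → U ≤ 1 → ‖z‖ ≤ 1 - U → ‖1 - z‖ ≤ C * U →
      ‖symbol m n z‖ ≤ M ∧ ‖symbolDeriv m n z‖ ≤ M * (n / (1 + n * U) ^ 2) ∧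
      U * ‖symbolDeriv2 m n z‖ ≤ M * (n / (1 + n * U) ^ 2) := by
  let G : ℕ → ℕ → ℝ := fun i b => Real.exp 3 * C ^ b * (b + i + 2).factorial
  have hG : ∀ i b, 0 ≤ G i b := fun i b => by positivity
  have hM : ∀ i b (k : ℕ), 0 ≤ k * G i b := fun i b k => mul_nonneg (Nat.cast_nonneg _) (hG i b)
  refine ⟨G 0 m + m * G 0 (m - 1) + G 1 m + (2 * m : ℕ) * G 1 (m - 1) +
    (m * (m - 1) : ℕ) * G 1 (m - 1 - 1), ?_, ?_⟩
  · linarith [hG 0 m, hM 0 (m - 1) m, hG 1 m, hM 1 (m - 1) (2 * m),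
      hM 1 (m - 1 - 1) (m * (m - 1))]
  intro n z U hU hU1 hz hz'
  set S : ℝ := 1 / (1 + n * U) ^ 2 with hS
  have hS0 : 0 ≤ S := by positivity
  have hS1 : S ≤ 1 := by
    rw [hS, div_le_one (by positivity)]
    exact one_le_pow₀ (le_add_of_nonneg_right (by positivity))
  have key : ∀ (a b i : ℕ), n ≤ a + 2 →
      (n : ℝ) ^ (b + i) * (U ^ i * ‖bernsteinMonomial a b z‖) ≤ G i b * S := fun a b i hn =>
    (pow_mul_norm_bernsteinMonomial_le i hn hU hU1 hC hz hz').trans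
      (le_of_eq (by simp only [G, hS]; ring))
  have hn0 : (0 : ℝ) ≤ n := Nat.cast_nonneg n
  have t1 : (n : ℝ) ^ m * ‖bernsteinMonomial n m z‖ ≤ G 0 m * S := by
    simpa using key n m 0 (by omega)
  have t2 : (n : ℝ) ^ m * (n * ‖bernsteinMonomial (n - 1) m z‖) ≤ G 0 m * (n * S) := by
    have := mul_le_mul_of_nonneg_left (key (n - 1) m 0 (by omega)) hn0
    simp only [add_zero, pow_zero, one_mul] at this
    linarith
  have t3 : (n : ℝ) ^ m * (m * ‖bernsteinMonomial n (m - 1) z‖) ≤ m * G 0 (m - 1) * (n * S) := by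
    rcases m with _ | b
    · simp
    · have := mul_le_mul_of_nonneg_left (key n b 0 (by omega))
        (mul_nonneg hn0 (Nat.cast_nonneg (α := ℝ) (b + 1)))
      simp only [add_zero, pow_zero, one_mul] at this
      simp only [Nat.add_sub_cancel]
      calc _ = n * ((b + 1 : ℕ) : ℝ) * (n ^ b * ‖bernsteinMonomial n b z‖) := by ring
        _ ≤ _ := this
        _ = _ := by ring
  have t4 : (n : ℝ) ^ m * (n * ((n - 1 : ℕ) * (U * ‖bernsteinMonomial (n - 1 - 1) m z‖))) ≤
      G 1 m * (n * S) := by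
    have hn1 : ((n - 1 : ℕ) : ℝ) ≤ n := by exact_mod_cast Nat.sub_le n 1
    have := mul_le_mul_of_nonneg_left (key (n - 1 - 1) m 1 (by omega)) hn0
    calc _ ≤ (n : ℝ) ^ m * (n * (n * (U * ‖bernsteinMonomial (n - 1 - 1) m z‖))) := by gcongr
      _ = n * (n ^ (m + 1) * (U ^ 1 * ‖bernsteinMonomial (n - 1 - 1) m z‖)) := by ring
      _ ≤ _ := this
      _ = _ := by ring
  have t5 : (n : ℝ) ^ m * (m * (n * (U * ‖bernsteinMonomial (n - 1) (m - 1) z‖))) ≤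
      m * G 1 (m - 1) * (n * S) := by
    rcases m with _ | b
    · simp
    · have := mul_le_mul_of_nonneg_left (key (n - 1) b 1 (by omega))
        (mul_nonneg hn0 (Nat.cast_nonneg (α := ℝ) (b + 1)))
      simp only [Nat.add_sub_cancel]
      calc _ = n * ((b + 1 : ℕ) : ℝ) * (n ^ (b + 1) * (U ^ 1 * ‖bernsteinMonomial (n - 1) b z‖)) := by
            ring
        _ ≤ _ := this
        _ = _ := by ring
  have t6 : (n : ℝ) ^ m * (m * ((m - 1 : ℕ) * (U * ‖bernsteinMonomial n (m - 1 - 1) z‖))) ≤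
      (m * (m - 1) : ℕ) * G 1 (m - 1 - 1) * (n * S) := by
    -- For m = 0 and m = 1 the factor m(m - 1) vanishes, so the truncated exponent m - 1 - 1 plays
    -- no role.
    rcases m with _ | _ | b
    · simp
    · simp
    · have := mul_le_mul_of_nonneg_left (key n b 1 (by omega))
        (mul_nonneg hn0 (Nat.cast_nonneg (α := ℝ) ((b + 2) * (b + 1))))
      simp only [Nat.add_sub_cancel]
      calc _ = n * (((b + 2) * (b + 1) : ℕ) : ℝ) *
            (n ^ (b + 1) * (U ^ 1 * ‖bernsteinMonomial n b z‖)) := by push_cast; ring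
        _ ≤ _ := this
        _ = _ := by ring
  have hnS : 0 ≤ n * S := by positivity
  have eS : (n : ℝ) / (1 + n * U) ^ 2 = n * S := by rw [hS]; ring
  rw [eS]
  have p1 := mul_nonneg (hG 0 m) hnS
  have p2 := mul_nonneg (hM 0 (m - 1) m) hnS
  have p3 := mul_nonneg (hG 1 m) hnS
  have p4 := mul_nonneg (hM 1 (m - 1) (2 * m)) hnS
  have p5 := mul_nonneg (hM 1 (m - 1 - 1) (m * (m - 1))) hnS
  refine ⟨?_, ?_, ?_⟩
  · have : ‖symbol m n z‖ = n ^ m * ‖bernsteinMonomial n m z‖ := by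
      rw [symbol, norm_mul, norm_pow, norm_natCast]
    rw [this]
    have := mul_le_of_le_one_right (hG 0 m) hS1
    linarith [hG 0 m, hM 0 (m - 1) m, hG 1 m, hM 1 (m - 1) (2 * m),
      hM 1 (m - 1 - 1) (m * (m - 1))]
  · have : ‖symbolDeriv m n z‖ ≤ n ^ m * (n * ‖bernsteinMonomial (n - 1) m z‖) +
        n ^ m * (m * ‖bernsteinMonomial n (m - 1) z‖) := by
      rw [symbolDeriv, norm_mul, norm_pow, norm_natCast, ← mul_add]
      gcongr
      refine (norm_sub_le _ _).trans (le_of_eq ?_)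
      simp only [norm_mul, norm_natCast]
    linarith
  · have : ‖symbolDeriv2 m n z‖ ≤
        n ^ m * (n * ((n - 1 : ℕ) * ‖bernsteinMonomial (n - 1 - 1) m z‖)) +
        2 * (n ^ m * (m * (n * ‖bernsteinMonomial (n - 1) (m - 1) z‖))) +
        n ^ m * (m * ((m - 1 : ℕ) * ‖bernsteinMonomial n (m - 1 - 1) z‖)) := by
      rw [symbolDeriv2, norm_mul, norm_pow, norm_natCast]
      have e : ‖(n : ℂ) * ((n - 1 : ℕ) * bernsteinMonomial (n - 1 - 1) m z -
            m * bernsteinMonomial (n - 1) (m - 1) z) -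
          m * (n * bernsteinMonomial (n - 1) (m - 1) z -
            (m - 1 : ℕ) * bernsteinMonomial n (m - 1 - 1) z)‖ ≤
          n * ((n - 1 : ℕ) * ‖bernsteinMonomial (n - 1 - 1) m z‖ +
            m * ‖bernsteinMonomial (n - 1) (m - 1) z‖) +
          m * (n * ‖bernsteinMonomial (n - 1) (m - 1) z‖ +
            (m - 1 : ℕ) * ‖bernsteinMonomial n (m - 1 - 1) z‖) := by
        refine (norm_sub_le _ _).trans ?_
        rw [norm_mul, norm_mul, norm_natCast, norm_natCast]
        gcongr <;>
        · refine (norm_sub_le _ _).trans (le_of_eq ?_)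
          simp only [norm_mul, norm_natCast]
      refine (mul_le_mul_of_nonneg_left e (by positivity)).trans (le_of_eq ?_)
      ring
    have h2 := mul_le_mul_of_nonneg_left this hU
    refine h2.trans ?_
    have e2 : ((2 * m : ℕ) : ℝ) = 2 * m := by push_cast; ring
    rw [e2] at p4 ⊢
    calc _ = (n : ℝ) ^ m * (n * ((n - 1 : ℕ) * (U * ‖bernsteinMonomial (n - 1 - 1) m z‖))) +
          2 * ((n : ℝ) ^ m * (m * (n * (U * ‖bernsteinMonomial (n - 1) (m - 1) z‖)))) +
          (n : ℝ) ^ m * (m * ((m - 1 : ℕ) * (U * ‖bernsteinMonomial n (m - 1 - 1) z‖))) := by ring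
      _ ≤ _ := by linarith

end Symbol

/-! ### Oscillatory integrals of majorized symbols. -/

/-- A continuous function `h` on `[0, π]` with `h 0 = 1` and `h π` real, twice differentiable on
`(0, π)`, and majorized by a function `U` as in hypothesis (H). -/
structure IsMajorizedSymbol (h h1 h2 : ℝ → ℂ) (U U1 : ℝ → ℝ) (C : ℝ) : Prop where
  continuous : Continuous h
  map_zero : h 0 = 1
  conj_pi : (starRingEnd ℂ) (h Real.pi) = h Real.pi
  continuousOn_deriv : ContinuousOn h1 (Set.Ioc 0 Real.pi)
  continuousOn_majorant : ContinuousOn U (Set.Ioc 0 Real.pi)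
  hasDerivAt : ∀ θ ∈ Set.Ioo 0 Real.pi, HasDerivAt h (h1 θ) θ
  hasDerivAt_deriv : ∀ θ ∈ Set.Ioo 0 Real.pi, HasDerivAt h1 (h2 θ) θ
  hasDerivAt_majorant : ∀ θ ∈ Set.Ioo 0 Real.pi, HasDerivAt U (U1 θ) θ
  pos : 0 < C
  majorized : MajorizedBy h h1 h2 U U1 1 C

namespace IsMajorizedSymbol

variable {h h1 h2 : ℝ → ℂ} {U U1 : ℝ → ℝ} {C : ℝ}

theorem majorant_le_one (H : IsMajorizedSymbol h h1 h2 U U1 C) {θ : ℝ}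
    (hθ : θ ∈ Set.Ioc 0 Real.pi) : U θ ≤ 1 := by
  have := (H.majorized θ hθ).1
  linarith [norm_nonneg (h θ)]

/-- Integrating |h'| ≤ CU' from ε to θ gives |h(θ) - h(ε)| ≤ C(U(θ) - U(ε)) ≤ CU(θ); then ε → 0 with
h(0) = 1. Since U ≤ 1 - |h|, the values of h stay in a Stolz region at 1. -/
theorem norm_one_sub_le (H : IsMajorizedSymbol h h1 h2 U U1 C) {θ : ℝ}
    (hθ : θ ∈ Set.Ioc 0 Real.pi) : ‖1 - h θ‖ ≤ C * U θ := by
  have key : ∀ ε ∈ Set.Ioo 0 θ, ‖h ε - h θ‖ ≤ C * U θ := by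
    intro ε hε
    have hin : ∀ x ∈ Set.Ico ε θ, x ∈ Set.Ioo 0 Real.pi := fun x hx =>
      ⟨hε.1.trans_le hx.1, hx.2.trans_le hθ.2⟩
    have hsub : Set.Icc ε θ ⊆ Set.Ioc 0 Real.pi := fun x hx =>
      ⟨hε.1.trans_le hx.1, hx.2.trans hθ.2⟩
    have := image_norm_le_of_norm_deriv_right_le_deriv_boundary' (a := ε) (b := θ)
      (f := fun x => h x - h ε) (f' := h1) (B := fun x => C * (U x - U ε))
      (B' := fun x => C * U1 x) (H.continuous.sub continuous_const).continuousOn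
      (fun x hx => ((H.hasDerivAt x (hin x hx)).sub_const _).hasDerivWithinAt) (by simp)
      (continuousOn_const.mul ((H.continuousOn_majorant.mono hsub).sub continuousOn_const))
      (fun x hx => (((H.hasDerivAt_majorant x (hin x hx)).sub_const _).const_mul _).hasDerivWithinAt)
      (fun x hx => (H.majorized x (Set.Ioo_subset_Ioc_self (hin x hx))).2.2.1)
      (Set.right_mem_Icc.2 hε.2.le)
    rw [norm_sub_rev]
    refine this.trans ?_
    have h0 := (H.majorized.nonneg H.pos (hsub (Set.left_mem_Icc.2 hε.2.le))).1
    have := H.pos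
    gcongr
    linarith
  have hlim : Filter.Tendsto (fun ε => ‖h ε - h θ‖) (nhdsWithin 0 (Set.Ioi 0))
      (nhds ‖1 - h θ‖) := by
    rw [← H.map_zero]
    exact (((H.continuous.sub continuous_const).norm).tendsto 0).mono_left nhdsWithin_le_nhds
  exact le_of_tendsto hlim (Filter.eventually_of_mem (Ioo_mem_nhdsGT hθ.1) key)

end IsMajorizedSymbol

/-- The factor `1 - e^{-iθ}`. -/
def shiftFactor (θ : ℝ) : ℂ := 1 - cexp (-(I * θ))

theorem hasDerivAt_cexp_mul_ofReal (a : ℂ) (θ : ℝ) :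
    HasDerivAt (fun θ : ℝ => cexp (a * θ)) (a * cexp (a * θ)) θ := by
  have h := ((hasDerivAt_id (θ : ℂ)).const_mul a).cexp.comp_ofReal
  simpa [mul_comm] using h

theorem hasDerivAt_shiftFactor (θ : ℝ) :
    HasDerivAt shiftFactor (I * cexp (-(I * θ))) θ := by
  have h := (hasDerivAt_cexp_mul_ofReal (-I) θ).const_sub 1
  rw [show shiftFactor = fun θ : ℝ => 1 - cexp (-(I * θ)) from rfl]
  simpa [neg_mul] using h

theorem hasDerivAt_shiftFactor_deriv (θ : ℝ) :
    HasDerivAt (fun θ : ℝ => I * cexp (-(I * θ))) (cexp (-(I * θ))) θ := by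
  have h := (hasDerivAt_cexp_mul_ofReal (-I) θ).const_mul I
  have e : I * (-I * cexp (-I * θ)) = cexp (-(I * θ)) := by
    rw [← mul_assoc, mul_neg, I_mul_I, neg_neg, one_mul, neg_mul]
  rw [e] at h
  simpa [neg_mul] using h

theorem norm_cexp_neg_I_mul (x θ : ℝ) : ‖cexp (-(I * x) * θ)‖ = 1 := by
  have : -(I * x) * θ = ((-(x * θ) : ℝ) : ℂ) * I := by push_cast; ring
  rw [this, norm_exp_ofReal_mul_I]

theorem norm_cexp_neg_I (θ : ℝ) : ‖cexp (-(I * θ))‖ = 1 := by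
  have := norm_cexp_neg_I_mul 1 θ
  simpa using this

theorem norm_shiftFactor_le {θ : ℝ} (hθ : 0 ≤ θ) : ‖shiftFactor θ‖ ≤ θ := by
  have h := image_norm_le_of_norm_deriv_right_le_deriv_boundary' (a := 0) (b := θ)
    (f := shiftFactor) (f' := fun θ => I * cexp (-(I * θ))) (B := fun x => x) (B' := fun _ => 1)
    (fun x _ => (hasDerivAt_shiftFactor x).continuousAt.continuousWithinAt)
    (fun x _ => (hasDerivAt_shiftFactor x).hasDerivWithinAt) (by simp [shiftFactor])
    continuousOn_id (fun x _ => (hasDerivAt_id x).hasDerivWithinAt)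
    (fun x _ => by simp [norm_cexp_neg_I])
  exact h (Set.right_mem_Icc.2 hθ)

theorem continuous_shiftFactor : Continuous shiftFactor := by
  unfold shiftFactor; fun_prop

/-- Two integrations by parts on `[ε, b]`. -/
theorem norm_boundary_sub_integral_le {g g1 g2 : ℝ → ℂ} {B B' : ℝ → ℝ} {ε b : ℝ}
    (hεb : ε ≤ b) (x : ℝ) (hx : x ≠ 0) (hg : Continuous g)
    (hg1 : ContinuousOn g1 (Set.Icc ε b)) (hB : ContinuousOn B (Set.Icc ε b))
    (d1 : ∀ θ ∈ Set.Ico ε b, HasDerivAt g (g1 θ) θ)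
    (d2 : ∀ θ ∈ Set.Ico ε b, HasDerivAt g1 (g2 θ) θ)
    (dB : ∀ θ ∈ Set.Ico ε b, HasDerivAt B (B' θ) θ)
    (hle : ∀ θ ∈ Set.Ico ε b, ‖g2 θ‖ ≤ B' θ) :
    ‖(g b * cexp (-(I * x) * b) / (-(I * x)) - g1 b * cexp (-(I * x) * b) / (-(I * x)) ^ 2 -
        ∫ θ in (0 : ℝ)..b, g θ * cexp (-(I * x) * θ)) -
      (g ε * cexp (-(I * x) * ε) / (-(I * x)) - g1 ε * cexp (-(I * x) * ε) / (-(I * x)) ^ 2 -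
        ∫ θ in (0 : ℝ)..ε, g θ * cexp (-(I * x) * θ))‖ ≤ (B b - B ε) / x ^ 2 := by
  set a : ℂ := -(I * x) with ha
  have ha0 : a ≠ 0 := by simp [ha, hx]
  have hna : ‖a‖ ^ 2 = x ^ 2 := by simp [ha]
  have hge : Continuous fun θ : ℝ => g θ * cexp (a * θ) := by fun_prop
  -- The derivative of F collapses to -g'' e^{aθ}/a², and F is compared with a primitive of its
  -- majorant. Hence g'' need not be integrated.
  let F : ℝ → ℂ := fun t => g t * cexp (a * t) / a - g1 t * cexp (a * t) / a ^ 2 -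
    ∫ θ in (0 : ℝ)..t, g θ * cexp (a * θ)
  have hF : ∀ θ ∈ Set.Ico ε b, HasDerivAt F (-(g2 θ * cexp (a * θ) / a ^ 2)) θ := by
    intro θ hθ
    have e1 := ((d1 θ hθ).mul (hasDerivAt_cexp_mul_ofReal a θ)).div_const a
    have e2 := ((d2 θ hθ).mul (hasDerivAt_cexp_mul_ofReal a θ)).div_const (a ^ 2)
    have e3 := intervalIntegral.integral_hasDerivAt_right (hge.intervalIntegrable 0 θ)
      (hge.stronglyMeasurableAtFilter _ _) hge.continuousAt
    refine ((e1.sub e2).sub e3).congr_deriv ?_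
    field_simp
    ring
  have hFc : ContinuousOn F (Set.Icc ε b) := by
    refine ((hge.continuousOn.div_const a).sub ((hg1.mul (by fun_prop)).div_const _)).sub ?_
    exact (intervalIntegral.continuous_primitive (fun _ _ => hge.intervalIntegrable _ _)
      0).continuousOn
  have := image_norm_le_of_norm_deriv_right_le_deriv_boundary' (a := ε) (b := b)
    (f := fun t => F t - F ε) (f' := fun θ => -(g2 θ * cexp (a * θ) / a ^ 2))
    (B := fun t => (B t - B ε) / x ^ 2) (B' := fun t => B' t / x ^ 2)
    (hFc.sub continuousOn_const) (fun θ hθ => ((hF θ hθ).sub_const _).hasDerivWithinAt) (by simp)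
    ((hB.sub continuousOn_const).div_const _)
    (fun θ hθ => (((dB θ hθ).sub_const _).div_const _).hasDerivWithinAt)
    (fun θ hθ => by
      rw [norm_neg, norm_div, norm_mul, norm_pow, hna, ha, norm_cexp_neg_I_mul, mul_one]
      gcongr
      exact hle θ hθ)
    (Set.right_mem_Icc.2 hεb)
  exact this

theorem conj_cexp_int_pi (x : ℤ) :
    (starRingEnd ℂ) (cexp (-(I * (x : ℝ)) * Real.pi)) = cexp (-(I * (x : ℝ)) * Real.pi) := by
  rw [← Complex.exp_conj, Complex.exp_eq_exp_iff_exists_int]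
  refine ⟨x, ?_⟩
  simp
  ring

theorem cexp_neg_I_pi : cexp (-(I * Real.pi)) = -1 := by
  rw [mul_comm, Complex.exp_neg, exp_pi_mul_I]; norm_num

theorem continuous_symbol (m n : ℕ) : Continuous (symbol m n) :=
  continuous_iff_continuousAt.2 fun z => (hasDerivAt_symbol m n z).continuousAt

theorem conj_symbol (m n : ℕ) (z : ℂ) :
    (starRingEnd ℂ) (symbol m n z) = symbol m n ((starRingEnd ℂ) z) := by
  simp [symbol, bernsteinMonomial]

/-- The symbol at a real point, 1 - e^{-iπ} = 2 and e^{-ixπ} = ±1 are all real, so dividing by -ix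
gives a purely imaginary number. This removes the only boundary term at π that is merely O(1/|x|).
-/
theorem re_boundary_pi_eq_zero (m n : ℕ) {z : ℂ} (hz : (starRingEnd ℂ) z = z) (x : ℤ) :
    (symbol m n z * shiftFactor Real.pi * cexp (-(I * (x : ℝ)) * Real.pi) /
      (-(I * (x : ℝ)))).re = 0 := by
  have h : (starRingEnd ℂ) (symbol m n z * shiftFactor Real.pi *
      cexp (-(I * (x : ℝ)) * Real.pi) / (-(I * (x : ℝ)))) =
      -(symbol m n z * shiftFactor Real.pi * cexp (-(I * (x : ℝ)) * Real.pi) /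
      (-(I * (x : ℝ)))) := by
    rw [map_div₀, map_mul, map_mul, conj_cexp_int_pi, conj_symbol, hz, shiftFactor, cexp_neg_I_pi]
    simp only [map_sub, map_one, map_neg, map_mul, conj_I, conj_ofReal, neg_mul, neg_neg, div_neg]
  have := congrArg Complex.re h
  rw [conj_re, neg_re] at this
  linarith

/-- The factor 1 - e^{-iθ}, of size at most θ, compensates the singularity of h'' at 0, since θ|h''|
≤ CU'. After two integrations by parts the integrand is dominated by the derivative of θ - 1/(1 +
nU), whose total variation does not depend on n. -/
theorem IsMajorizedSymbol.exists_re_integral_le {h h1 h2 : ℝ → ℂ} {U U1 : ℝ → ℝ} {C : ℝ}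
    (H : IsMajorizedSymbol h h1 h2 U U1 C) (m : ℕ) :
    ∃ D : ℝ, 0 ≤ D ∧ ∀ (n : ℕ) (x : ℤ), x ≠ 0 →
      |(∫ θ in (0 : ℝ)..Real.pi, symbol m n (h θ) * shiftFactor θ *
        cexp (-(I * (x : ℝ)) * θ)).re| ≤ D / (x : ℝ) ^ 2 := by
  have hC := H.pos
  obtain ⟨M, hM, hbd⟩ := exists_symbol_bounds m hC.le
  have bd : ∀ (n : ℕ) (θ : ℝ), θ ∈ Set.Ioc 0 Real.pi → ‖symbol m n (h θ)‖ ≤ M ∧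
      ‖symbolDeriv m n (h θ)‖ ≤ M * (n / (1 + n * U θ) ^ 2) ∧
      U θ * ‖symbolDeriv2 m n (h θ)‖ ≤ M * (n / (1 + n * U θ) ^ 2) := fun n θ hθ =>
    hbd n (h θ) (U θ) (H.majorized.nonneg hC hθ).1 (H.majorant_le_one hθ)
      (by simpa using (H.majorized θ hθ).1) (H.norm_one_sub_le hθ)
  set Cb : ℝ := M * (C ^ 2 + 3 * C + 1) with hCb
  set M1 : ℝ := M * C + M with hM1
  have hCb0 : 0 ≤ Cb := by positivity
  have hM10 : 0 ≤ M1 := by positivity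
  -- In order, the five summands bound the g' boundary term at π, the second-order integral, the g
  -- and g' boundary terms at ε, and the integral over [0, ε].
  refine ⟨M1 + Cb * (Real.pi + 1) + M + M1 + M, by have := Real.pi_pos; positivity,
    fun n x hx => ?_⟩
  set g : ℝ → ℂ := fun θ => symbol m n (h θ) * shiftFactor θ with hg
  let F1 : ℝ → ℂ := fun θ => symbolDeriv m n (h θ) * h1 θ
  let F2 : ℝ → ℂ := fun θ => symbolDeriv2 m n (h θ) * h1 θ * h1 θ + symbolDeriv m n (h θ) * h2 θ
  let w1 : ℝ → ℂ := fun θ => I * cexp (-(I * θ))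
  let g1 : ℝ → ℂ := fun θ => F1 θ * shiftFactor θ + symbol m n (h θ) * w1 θ
  let g2 : ℝ → ℂ := fun θ => F2 θ * shiftFactor θ + F1 θ * w1 θ +
    (F1 θ * w1 θ + symbol m n (h θ) * cexp (-(I * θ)))
  have hw1 : ∀ θ, ‖w1 θ‖ = 1 := fun θ => by simp [w1, norm_cexp_neg_I]
  have csymbol := continuous_symbol m n
  have csymbolDeriv : Continuous (symbolDeriv m n) :=
    continuous_iff_continuousAt.2 fun z => (hasDerivAt_symbolDeriv m n z).continuousAt
  have gcont : Continuous g := (csymbol.comp H.continuous).mul continuous_shiftFactor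
  have w1cont : Continuous w1 := by fun_prop
  have g1cont : ContinuousOn g1 (Set.Ioc 0 Real.pi) :=
    ((((csymbolDeriv.comp H.continuous).continuousOn).mul H.continuousOn_deriv).mul
      continuous_shiftFactor.continuousOn).add
      (((csymbol.comp H.continuous).mul w1cont).continuousOn)
  have dF : ∀ θ ∈ Set.Ioo 0 Real.pi, HasDerivAt (fun θ => symbol m n (h θ)) (F1 θ) θ :=
    fun θ hθ => (hasDerivAt_symbol m n (h θ)).comp θ (H.hasDerivAt θ hθ)
  have dF1 : ∀ θ ∈ Set.Ioo 0 Real.pi, HasDerivAt F1 (F2 θ) θ := fun θ hθ =>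
    ((hasDerivAt_symbolDeriv m n (h θ)).comp θ (H.hasDerivAt θ hθ)).mul (H.hasDerivAt_deriv θ hθ)
  have d1 : ∀ θ ∈ Set.Ioo 0 Real.pi, HasDerivAt g (g1 θ) θ := fun θ hθ =>
    (dF θ hθ).mul (hasDerivAt_shiftFactor θ)
  have d2 : ∀ θ ∈ Set.Ioo 0 Real.pi, HasDerivAt g1 (g2 θ) θ := fun θ hθ =>
    ((dF1 θ hθ).mul (hasDerivAt_shiftFactor θ)).add
      ((dF θ hθ).mul (hasDerivAt_shiftFactor_deriv θ))
  have hF1 : ∀ θ ∈ Set.Ioc 0 Real.pi, θ * ‖F1 θ‖ ≤ M * C := by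
    intro θ hθ
    obtain ⟨-, b1, -⟩ := bd n θ hθ
    have hU := (H.majorized.nonneg hC hθ).1
    have m1 := (H.majorized θ hθ).2.1
    rw [norm_mul, norm_real, Real.norm_of_nonneg hθ.1.le] at m1
    have hθ0 := hθ.1.le
    -- Uniformity in n here is just nU ≤ (1 + nU)².
    have hs : n / (1 + n * U θ) ^ 2 * U θ ≤ 1 := by
      rw [div_mul_eq_mul_div, div_le_one (by positivity)]
      nlinarith [mul_nonneg (Nat.cast_nonneg (α := ℝ) n) hU]
    calc θ * ‖F1 θ‖ = ‖symbolDeriv m n (h θ)‖ * (θ * ‖h1 θ‖) := by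
          simp only [F1, norm_mul]; ring
      _ ≤ M * (n / (1 + n * U θ) ^ 2) * (C * U θ) := by gcongr
      _ = M * C * (n / (1 + n * U θ) ^ 2 * U θ) := by ring
      _ ≤ M * C := mul_le_of_le_one_right (by positivity) hs
  have hg1 : ∀ θ ∈ Set.Ioc 0 Real.pi, ‖g1 θ‖ ≤ M1 := by
    intro θ hθ
    refine (norm_add_le _ _).trans ?_
    rw [norm_mul (F1 θ), norm_mul (symbol m n (h θ)), hw1, mul_one]
    refine add_le_add (le_trans ?_ (hF1 θ hθ)) (bd n θ hθ).1
    rw [mul_comm]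
    gcongr
    exact norm_shiftFactor_le hθ.1.le
  have hgle : ∀ θ ∈ Set.Ioc 0 Real.pi, ‖g θ‖ ≤ M * θ := by
    intro θ hθ
    simp only [hg, norm_mul]
    exact mul_le_mul (bd n θ hθ).1 (norm_shiftFactor_le hθ.1.le) (norm_nonneg _) hM
  have hg2 : ∀ θ ∈ Set.Ioc 0 Real.pi,
      ‖g2 θ‖ ≤ Cb * (1 + n * U1 θ / (1 + n * U θ) ^ 2) := by
    intro θ hθ
    obtain ⟨b0, b1, b2⟩ := bd n θ hθ
    obtain ⟨hU, hU1⟩ := H.majorized.nonneg hC hθ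
    obtain ⟨-, m1, m2, m3⟩ := H.majorized θ hθ
    rw [norm_mul, norm_real, Real.norm_of_nonneg hθ.1.le] at m1 m3
    have hθ0 := hθ.1.le
    have hsf := norm_shiftFactor_le hθ.1.le
    set S : ℝ := n / (1 + n * U θ) ^ 2 with hS
    have hS0 : 0 ≤ S := by positivity
    have f1 : ‖F1 θ‖ ≤ M * C * (S * U1 θ) := by
      simp only [F1, norm_mul]
      calc _ ≤ M * S * (C * U1 θ) := by gcongr
        _ = _ := by ring
    have f2 : ‖F2 θ * shiftFactor θ‖ ≤ M * (C ^ 2 + C) * (S * U1 θ) := by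
      rw [norm_mul]
      calc ‖F2 θ‖ * ‖shiftFactor θ‖
          ≤ (‖symbolDeriv2 m n (h θ)‖ * ‖h1 θ‖ * ‖h1 θ‖ + ‖symbolDeriv m n (h θ)‖ * ‖h2 θ‖) * θ := by
            gcongr
            refine (norm_add_le _ _).trans ?_
            simp only [norm_mul, le_refl]
        _ = ‖symbolDeriv2 m n (h θ)‖ * (θ * ‖h1 θ‖) * ‖h1 θ‖ +
            ‖symbolDeriv m n (h θ)‖ * (θ * ‖h2 θ‖) := by ring
        _ ≤ ‖symbolDeriv2 m n (h θ)‖ * (C * U θ) * (C * U1 θ) + M * S * (C * U1 θ) := by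
            gcongr
        _ = (U θ * ‖symbolDeriv2 m n (h θ)‖) * (C ^ 2 * U1 θ) + M * S * (C * U1 θ) := by ring
        _ ≤ M * S * (C ^ 2 * U1 θ) + M * S * (C * U1 θ) := by gcongr
        _ = _ := by ring
    have hx1 : ‖F1 θ * w1 θ‖ = ‖F1 θ‖ := by rw [norm_mul, hw1, mul_one]
    have hx2 : ‖symbol m n (h θ) * cexp (-(I * θ))‖ = ‖symbol m n (h θ)‖ := by
      rw [norm_mul, norm_cexp_neg_I, mul_one]
    have hSU : 0 ≤ S * U1 θ := by positivity
    have e : n * U1 θ / (1 + n * U θ) ^ 2 = S * U1 θ := by rw [hS]; ring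
    rw [e]
    calc ‖g2 θ‖ ≤ ‖F2 θ * shiftFactor θ‖ + ‖F1 θ * w1 θ‖ +
          (‖F1 θ * w1 θ‖ + ‖symbol m n (h θ) * cexp (-(I * θ))‖) :=
          (norm_add_le _ _).trans (add_le_add (norm_add_le _ _) (norm_add_le _ _))
      _ ≤ M * (C ^ 2 + C) * (S * U1 θ) + M * C * (S * U1 θ) + (M * C * (S * U1 θ) + M) := by
          rw [hx1, hx2]; gcongr
      _ = M * (C ^ 2 + 3 * C) * (S * U1 θ) + M := by ring
      _ ≤ Cb * (1 + S * U1 θ) := by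
          have q1 : 0 ≤ M * (C ^ 2 + 3 * C) := by positivity
          have q2 := mul_nonneg hM hSU
          rw [hCb]
          linarith
  have hxR : (x : ℝ) ≠ 0 := by exact_mod_cast hx
  have hx1 : (1 : ℝ) ≤ |(x : ℝ)| := by exact_mod_cast Int.one_le_abs hx
  have hx2 : (1 : ℝ) ≤ (x : ℝ) ^ 2 := by rw [← sq_abs]; exact one_le_pow₀ hx1
  have hx20 : (0 : ℝ) < (x : ℝ) ^ 2 := by linarith
  -- As |g(θ)| ≤ Mθ, this cutoff makes both the integral over [0, ε] and the boundary term g(ε)/x of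
  -- size O(1/x²).
  set ε : ℝ := 1 / (x : ℝ) ^ 2 with hε
  have hε0 : 0 < ε := by positivity
  have hε1 : ε ≤ 1 := by rw [hε, div_le_one hx20]; exact hx2
  have hεπ : ε < Real.pi := by linarith [Real.pi_gt_three]
  have hsub : Set.Icc ε Real.pi ⊆ Set.Ioc 0 Real.pi := fun t ht => ⟨hε0.trans_le ht.1, ht.2⟩
  have hsub' : Set.Ico ε Real.pi ⊆ Set.Ioo 0 Real.pi := fun t ht => ⟨hε0.trans_le ht.1, ht.2⟩
  have hpos : ∀ θ ∈ Set.Ioc 0 Real.pi, 0 < 1 + n * U θ := fun θ hθ => by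
    have := mul_nonneg (Nat.cast_nonneg (α := ℝ) n) (H.majorized.nonneg hC hθ).1
    linarith
  have main := norm_boundary_sub_integral_le (g := g) (g1 := g1) (g2 := g2)
    (B := fun θ => Cb * (θ - (1 + n * U θ)⁻¹))
    (B' := fun θ => Cb * (1 + n * U1 θ / (1 + n * U θ) ^ 2)) hεπ.le x hxR gcont
    (g1cont.mono hsub)
    (continuousOn_const.mul (continuousOn_id.sub (ContinuousOn.inv₀
      (continuousOn_const.add (continuousOn_const.mul (H.continuousOn_majorant.mono hsub)))
      fun θ hθ => (hpos θ (hsub hθ)).ne')))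
    (fun θ hθ => d1 θ (hsub' hθ)) (fun θ hθ => d2 θ (hsub' hθ))
    (fun θ hθ => by
      have hθ' := hsub' hθ
      have hd := (((H.hasDerivAt_majorant θ hθ').const_mul (n : ℝ)).const_add 1).fun_inv
        (hpos θ (Set.Ioo_subset_Ioc_self hθ')).ne'
      refine (((hasDerivAt_id θ).sub hd).const_mul Cb).congr_deriv ?_
      ring)
    (fun θ hθ => hg2 θ (Set.Ioo_subset_Ioc_self (hsub' hθ)))
  have hπmem : Real.pi ∈ Set.Ioc 0 Real.pi := ⟨Real.pi_pos, le_rfl⟩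
  have hεmem : ε ∈ Set.Ioc 0 Real.pi := ⟨hε0, hεπ.le⟩
  set a : ℂ := -(I * (x : ℝ)) with ha
  have hna : ‖a‖ = |(x : ℝ)| := by simp [ha]
  have hna2 : ‖a‖ ^ 2 = (x : ℝ) ^ 2 := by rw [hna, sq_abs]
  have hexp : ∀ θ : ℝ, ‖cexp (a * θ)‖ = 1 := fun θ => norm_cexp_neg_I_mul x θ
  set E := ∫ θ in (0 : ℝ)..Real.pi, g θ * cexp (a * θ)
  set Eε := ∫ θ in (0 : ℝ)..ε, g θ * cexp (a * θ)
  set X := g Real.pi * cexp (a * Real.pi) / a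
  set Y := g1 Real.pi * cexp (a * Real.pi) / a ^ 2
  set Xε := g ε * cexp (a * ε) / a
  set Yε := g1 ε * cexp (a * ε) / a ^ 2
  have hX : X.re = 0 := re_boundary_pi_eq_zero m n H.conj_pi x
  have hY : ‖Y‖ ≤ M1 / (x : ℝ) ^ 2 := by
    simp only [Y, norm_div, norm_mul, hexp, mul_one, norm_pow, hna2]
    gcongr
    exact hg1 _ hπmem
  have hYε : ‖Yε‖ ≤ M1 / (x : ℝ) ^ 2 := by
    simp only [Yε, norm_div, norm_mul, hexp, mul_one, norm_pow, hna2]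
    gcongr
    exact hg1 _ hεmem
  have hXε : ‖Xε‖ ≤ M / (x : ℝ) ^ 2 := by
    simp only [Xε, norm_div, norm_mul, hexp, mul_one, hna]
    refine (div_le_self (norm_nonneg _) hx1).trans ((hgle ε hεmem).trans (le_of_eq ?_))
    rw [hε]; ring
  have hEε : ‖Eε‖ ≤ M / (x : ℝ) ^ 2 := by
    have := intervalIntegral.norm_integral_le_of_norm_le_const (a := 0) (b := ε) (C := M)
      (f := fun θ : ℝ => g θ * cexp (a * θ)) (fun θ hθ => by
        rw [Set.uIoc_of_le hε0.le] at hθ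
        rw [norm_mul, hexp, mul_one]
        refine (hgle θ ⟨hθ.1, hθ.2.trans hεπ.le⟩).trans ?_
        exact mul_le_of_le_one_right hM (hθ.2.trans hε1))
    refine this.trans (le_of_eq ?_)
    rw [sub_zero, abs_of_pos hε0, hε]; ring
  have hB : (Cb * (Real.pi - (1 + n * U Real.pi)⁻¹) - Cb * (ε - (1 + n * U ε)⁻¹)) / (x : ℝ) ^ 2 ≤
      Cb * (Real.pi + 1) / (x : ℝ) ^ 2 := by
    rw [← mul_sub]
    gcongr
    have i1 : 0 ≤ (1 + n * U Real.pi)⁻¹ := (inv_pos.2 (hpos _ hπmem)).le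
    have i2 : (1 + n * U ε)⁻¹ ≤ 1 := inv_le_one_of_one_le₀ (by
      have := mul_nonneg (Nat.cast_nonneg (α := ℝ) n) (H.majorized.nonneg hC hεmem).1
      linarith)
    linarith
  have hE : E.re = -Y.re - (X - Y - E - (Xε - Yε - Eε)).re - Xε.re + Yε.re + Eε.re := by
    simp only [sub_re, hX]; ring
  have r := fun z : ℂ => abs_le.1 (abs_re_le_norm z)
  have hW := main.trans hB
  rw [show (M1 + Cb * (Real.pi + 1) + M + M1 + M) / (x : ℝ) ^ 2 = M1 / (x : ℝ) ^ 2 +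
    Cb * (Real.pi + 1) / (x : ℝ) ^ 2 + M / (x : ℝ) ^ 2 + M1 / (x : ℝ) ^ 2 + M / (x : ℝ) ^ 2 by ring]
  have r1 := r Y
  have r2 := r (X - Y - E - (Xε - Yε - Eε))
  have r3 := r Xε
  have r4 := r Yε
  have r5 := r Eε
  rw [hE, abs_le]
  constructor <;> linarith [r1.1, r1.2, r2.1, r2.2, r3.1, r3.2, r4.1, r4.2, r5.1, r5.2]

/-! ### Regularity of the kernels of a measure in class H. -/

theorem fourierZ_neg_pi (μ : Measure ℤ) : fourierZ μ (-Real.pi) = fourierZ μ Real.pi := by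
  rw [fourierZ_eq_integral, fourierZ_eq_integral]
  refine integral_congr_ae (Filter.Eventually.of_forall fun k => ?_)
  simp only
  rw [Complex.exp_eq_exp_iff_exists_int]
  exact ⟨-k, by push_cast; ring⟩

theorem MajorizedBy.rescale {f f1 f2 : ℝ → ℂ} {ψ ψ1 : ℝ → ℝ} {c C : ℝ} (hc : 0 < c)
    (h : MajorizedBy f f1 f2 ψ ψ1 c C) :
    MajorizedBy f f1 f2 (fun θ => c * ψ θ) (fun θ => c * ψ1 θ) 1 (C / c) := by
  intro θ hθ
  have e : ∀ y : ℝ, C / c * (c * y) = C * y := fun y => by field_simp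
  simpa only [one_mul, e] using h θ hθ

theorem punctured_mem_nhds {θ : ℝ} (hθ : θ ∈ Set.Ioo 0 Real.pi) : punctured ∈ nhds θ :=
  Filter.mem_of_superset (isOpen_Ioo.mem_nhds hθ) fun _ hx =>
    mem_punctured_of_mem_Ioc (Set.Ioo_subset_Ioc_self hx)

theorem exists_isMajorizedSymbol {μ : Measure ℤ} (hμ : μ ∈ classH) :
    ∃ (h1 h2 : ℝ → ℂ) (U U1 : ℝ → ℝ) (C : ℝ), IsMajorizedSymbol (fourierZ μ) h1 h2 U U1 C := by
  obtain ⟨hp, hf, f1, f2, ψ, ψ1, c, C, hc, hC, hf1, hf2, -, -, -, -, hψ1, h⟩ :=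
    exists_majorizedBy_of_mem_classH hμ
  have hsub : Set.Ioc 0 Real.pi ⊆ punctured := fun _ => mem_punctured_of_mem_Ioc
  have hsub' : ∀ θ ∈ Set.Ioo 0 Real.pi, θ ∈ punctured := fun θ hθ =>
    hsub (Set.Ioo_subset_Ioc_self hθ)
  exact ⟨f1, f2, fun θ => c * ψ θ, fun θ => c * ψ1 θ, C / c,
    { continuous := continuous_fourierZ μ
      map_zero := fourierZ_zero μ
      conj_pi := by rw [← fourierZ_neg, fourierZ_neg_pi]
      continuousOn_deriv := fun θ hθ => (hf2 θ (hsub hθ)).continuousWithinAt.mono hsub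
      continuousOn_majorant := fun θ hθ =>
        (((hψ1 θ (hsub hθ)).const_mul c).continuousWithinAt).mono hsub
      hasDerivAt := fun θ hθ => (hf1 θ (hsub' θ hθ)).hasDerivAt (punctured_mem_nhds hθ)
      hasDerivAt_deriv := fun θ hθ => (hf2 θ (hsub' θ hθ)).hasDerivAt (punctured_mem_nhds hθ)
      hasDerivAt_majorant := fun θ hθ =>
        ((hψ1 θ (hsub' θ hθ)).hasDerivAt (punctured_mem_nhds hθ)).const_mul c
      pos := div_pos hC hc
      majorized := h.rescale hc }⟩

theorem integral_eq_two_mul_re {G : ℝ → ℂ} (hG : Continuous G) (b : ℝ)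
    (hneg : ∀ θ, G (-θ) = (starRingEnd ℂ) (G θ)) :
    ∫ θ in -b..b, G θ = ((2 * (∫ θ in (0 : ℝ)..b, G θ).re : ℝ) : ℂ) := by
  rw [← intervalIntegral.integral_add_adjacent_intervals (hG.intervalIntegrable (-b) 0)
    (hG.intervalIntegrable 0 b)]
  have h1 : ∫ θ in -b..0, G θ = (starRingEnd ℂ) (∫ θ in (0 : ℝ)..b, G θ) := by
    have h2 := intervalIntegral.integral_comp_neg (a := 0) (b := b) G
    rw [neg_zero] at h2
    rw [← h2]
    simp only [hneg]
    exact conjCLE.toContinuousLinearMap.intervalIntegral_comp_comm (hG.intervalIntegrable 0 b)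
  rw [h1, add_comm, add_conj]

/-- The kernel `n^m μ^{*n} * (δ₀ - μ)^{*m}`. -/
def weightedKernel (μ : Measure ℤ) (m n : ℕ) : ℤ → ℂ := ((n : ℂ) ^ m) • diffKernel μ m n

theorem summable_weightedKernel (μ : Measure ℤ) [IsProbabilityMeasure μ] (m n : ℕ) :
    Summable (weightedKernel μ m n) := summable_smul _ (summable_diffKernel μ m n)

theorem hat_weightedKernel (μ : Measure ℤ) [IsProbabilityMeasure μ] (m n : ℕ) (θ : ℝ) :
    hat (weightedKernel μ m n) θ = symbol m n (fourierZ μ θ) := by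
  rw [weightedKernel, hat_smul, hat_diffKernel, symbol, bernsteinMonomial]

/-- Translating by one multiplies the symbol by e^{-iθ}. Hermitian symmetry reduces the Fourier
integral to the real part over [0, π], the half where hypothesis (H) gives bounds. -/
theorem weightedKernel_sub_succ (μ : Measure ℤ) [IsProbabilityMeasure μ] (m n : ℕ) (x : ℤ) :
    (Real.pi : ℂ) * (weightedKernel μ m n x - weightedKernel μ m n (x + 1)) =
      (((∫ θ in (0 : ℝ)..Real.pi, symbol m n (fourierZ μ θ) * shiftFactor θ *
        cexp (-(I * (x : ℝ)) * θ)).re : ℝ) : ℂ) := by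
  have hK := summable_weightedKernel μ m n
  have hcont : Continuous fun θ => symbol m n (fourierZ μ θ) :=
    (continuous_symbol m n).comp (continuous_fourierZ μ)
  have h1 := integral_hat_mul hK x
  have h2 := integral_hat_mul hK (x + 1)
  simp only [hat_weightedKernel] at h1 h2
  have h3 := integral_eq_two_mul_re
    (G := fun θ => symbol m n (fourierZ μ θ) * shiftFactor θ * cexp (-(I * (x : ℝ)) * θ))
    ((hcont.mul continuous_shiftFactor).mul (by fun_prop)) Real.pi (fun θ => by
      rw [fourierZ_neg, map_mul, map_mul, conj_symbol, ← Complex.exp_conj, shiftFactor, shiftFactor,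
        map_sub, ← Complex.exp_conj]
      simp)
  have h4 : ∫ θ in -Real.pi..Real.pi,
      symbol m n (fourierZ μ θ) * shiftFactor θ * cexp (-(I * (x : ℝ)) * θ) =
      2 * Real.pi * weightedKernel μ m n x - 2 * Real.pi * weightedKernel μ m n (x + 1) := by
    have hc : ∀ y : ℤ, Continuous fun θ : ℝ => symbol m n (fourierZ μ θ) * cexp (-(I * y * θ)) :=
      fun y => hcont.mul (by fun_prop)
    rw [← h1, ← h2, ← intervalIntegral.integral_sub ((hc x).intervalIntegrable _ _)
      ((hc (x + 1)).intervalIntegrable _ _)]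
    refine intervalIntegral.integral_congr fun θ _ => ?_
    have e1 : cexp (-(I * (x : ℝ)) * θ) = cexp (-(I * x * θ)) := by congr 1; push_cast; ring
    have e2 : cexp (-(I * (x + 1 : ℤ) * θ)) = cexp (-(I * θ)) * cexp (-(I * x * θ)) := by
      rw [← Complex.exp_add]; congr 1; push_cast; ring
    simp only [shiftFactor]
    rw [e1, e2]
    ring
  rw [h4] at h3
  push_cast at h3
  linear_combination h3 / 2

theorem exists_weightedKernel_regular {μ : Measure ℤ} (hμ : μ ∈ classH) (m : ℕ) :
    ∃ D : ℝ, 0 ≤ D ∧ ∀ (n : ℕ) (x : ℤ), x ≠ 0 →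
      ‖weightedKernel μ m n x - weightedKernel μ m n (x + 1)‖ ≤ D / (x : ℝ) ^ 2 := by
  have hp : IsProbabilityMeasure μ := hμ.1
  obtain ⟨h1, h2, U, U1, C, H⟩ := exists_isMajorizedSymbol hμ
  obtain ⟨D, hD, h⟩ := H.exists_re_integral_le m
  refine ⟨D, hD, fun n x hx => ?_⟩
  have e := congrArg norm (weightedKernel_sub_succ μ m n x)
  rw [norm_mul, norm_real, norm_real, Real.norm_of_nonneg Real.pi_pos.le, Real.norm_eq_abs] at e
  have := h n x hx
  rw [← e] at this
  exact (le_mul_of_one_le_left (norm_nonneg _) (by linarith [Real.pi_gt_three])).trans this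

/-! ### The maximal inequalities. -/

theorem conv_smul_left (c : ℂ) (a b : ℤ → ℂ) (k : ℤ) : conv (c • a) b k = c * conv a b k := by
  simp only [conv, Pi.smul_apply, smul_eq_mul, mul_assoc, tsum_mul_left]

theorem enorm_natCast_complex (n : ℕ) : ‖(n : ℂ)‖ₑ = n := by
  rw [← ofReal_norm]; simp

theorem l1norm_weightedKernel (μ : Measure ℤ) (m n : ℕ) :
    l1norm (weightedKernel μ m n) = (n : ℝ≥0∞) ^ m * l1norm (diffKernel μ m n) := by
  rw [weightedKernel, l1norm_smul, enorm_pow, enorm_natCast_complex]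

theorem weightedMaximal_le (μ : Measure ℤ) (m : ℕ) (f : ℤ → ℂ) (k : ℤ) :
    weightedMaximal μ m f k ≤ ⨆ n, ‖conv (weightedKernel μ m n) f k‖ₑ := by
  refine iSup₂_le fun n _ => le_trans (le_of_eq ?_)
    (le_iSup (fun n => ‖conv (weightedKernel μ m n) f k‖ₑ) n)
  rw [weightedKernel, conv_smul_left, enorm_mul, enorm_pow, enorm_natCast_complex]
  rfl

theorem exists_weak_type_weightedKernel {μ : Measure ℤ} (hμ : μ ∈ classH) (m : ℕ) {A : ℝ≥0∞}
    (hA : A < ∞) (hK : ∀ n, l1norm (weightedKernel μ m n) ≤ A) :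
    ∃ C : ℝ≥0, 0 < C ∧ ∀ f : ℤ → ℂ, l1norm f < ∞ → ∀ t : ℝ≥0∞, t ≠ 0 →
      t * ({k : ℤ | t < ⨆ n, ‖conv (weightedKernel μ m n) f k‖ₑ}.encard : ℝ≥0∞) ≤
        (C : ℝ≥0∞) * l1norm f := by
  obtain ⟨D, hD, h⟩ := exists_weightedKernel_regular hμ m
  have hfin : 16 * (A + 1) + 4 * ENNReal.ofReal (8 * D) ≠ ∞ := by
    simp [ENNReal.mul_eq_top, hA.ne]
  -- Using A + 1 in place of A ensures that the ℓ¹ bound is nonzero.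
  refine ⟨(16 * (A + 1) + 4 * ENNReal.ofReal (8 * D)).toNNReal,
    ENNReal.toNNReal_pos (by simp) hfin, fun f hf t ht => ?_⟩
  rw [ENNReal.coe_toNNReal hfin]
  exact weak_type_of_hormander (ENNReal.add_lt_top.2 ⟨hA, ENNReal.one_lt_top⟩) (by simp)
    (fun n => (hK n).trans le_self_add) (hormander_of_regular hD h) hf ht

theorem weightedKernel_zero (μ : Measure ℤ) [IsProbabilityMeasure μ] (n : ℕ) :
    weightedKernel μ 0 n = convPow (mass μ) n :=
  hat_injective (summable_weightedKernel μ 0 n) (summable_convPow (summable_mass μ) n) fun θ => by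
    rw [hat_weightedKernel, hat_convPow (summable_mass μ), hat_mass]
    simp [symbol, bernsteinMonomial]

theorem maximal_eq_zero {μ : Measure ℤ} {f : ℤ → ℂ} (hf : l1norm f = 0) (k : ℤ) :
    maximal μ f k = 0 := by
  have h0 : ∀ k, f k = 0 := fun k => by
    have := (enorm_le_l1norm f k).trans hf.le
    simpa using this
  simp [maximal, conv, h0]

theorem weakMaximalInequality_of_mem_classH {μ : Measure ℤ} (hμ : μ ∈ classH) :
    WeakMaximalInequality μ := by
  have hp : IsProbabilityMeasure μ := hμ.1
  obtain ⟨C, hC, h⟩ := exists_weak_type_weightedKernel hμ 0 ENNReal.one_lt_top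
    (fun n => by rw [weightedKernel_zero]; exact l1norm_convPow_mass_le_one μ n)
  refine ⟨C, hC, fun f hf t => ?_⟩
  rcases eq_or_ne t 0 with rfl | ht
  -- At height 0 the right-hand side is ∞ unless f = 0, since C/0 = ∞ and ∞·0 = 0; for f = 0 the
  -- level set is empty.
  · rcases eq_or_ne (l1norm f) 0 with h0 | h0
    · simp [maximal_eq_zero h0]
    · rw [ENNReal.coe_zero, ENNReal.div_zero (by simpa using hC.ne'), ENNReal.top_mul h0]
      exact le_top
  · have ht' : (t : ℝ≥0∞) ≠ 0 := by simpa using ht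
    have key : (t : ℝ≥0∞) * ({k : ℤ | (t : ℝ≥0∞) < maximal μ f k}.encard : ℝ≥0∞) ≤
        (C : ℝ≥0∞) * l1norm f := by
      refine le_trans ?_ (h f hf t ht')
      gcongr with k
      refine iSup₂_le fun n _ => ?_
      rw [← weightedKernel_zero]
      exact le_iSup (fun n => ‖conv (weightedKernel μ 0 n) f k‖ₑ) n
    rw [← ENNReal.mul_div_right_comm, ENNReal.le_div_iff_mul_le (Or.inl ht') (Or.inl (by simp)),
      mul_comm]
    exact key

theorem weightedWeakMaximalInequality_of_mem {μ : Measure ℤ} (hμ : μ ∈ classH) (hμ' : μ ∈ classR)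
    (m : ℕ) : WeightedWeakMaximalInequality μ m := by
  obtain ⟨A, hA, hK⟩ := exists_l1norm_diffKernel_le hμ' m
  obtain ⟨C, hC, h⟩ := exists_weak_type_weightedKernel hμ m hA
    (fun n => by rw [l1norm_weightedKernel]; exact hK n)
  -- The factor 2 pays for replacing the level set ≥ t by the strict one > t/2.
  refine ⟨2 * C, by positivity, fun f hf => iSup₂_le fun t ht => ?_⟩
  have ht' : (t : ℝ≥0∞) ≠ 0 := by simpa using ht.ne'
  have hhalf : (t : ℝ≥0∞) / 2 < t := ENNReal.half_lt_self ht' (by simp)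
  calc (t : ℝ≥0∞) * ({k : ℤ | (t : ℝ≥0∞) ≤ weightedMaximal μ m f k}.encard : ℝ≥0∞)
      = 2 * ((t : ℝ≥0∞) / 2 * ({k : ℤ | (t : ℝ≥0∞) ≤ weightedMaximal μ m f k}.encard : ℝ≥0∞)) := by
        rw [← mul_assoc, ENNReal.mul_div_cancel (by simp) (by simp)]
    _ ≤ 2 * ((C : ℝ≥0∞) * l1norm f) := by
        refine mul_le_mul_right (le_trans ?_ (h f hf (t / 2) (ENNReal.half_pos ht').ne')) 2
        refine mul_le_mul_right (ENat.toENNReal_le.2 (Set.encard_le_encard fun k hk => ?_)) _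
        exact hhalf.trans_le ((show (t : ℝ≥0∞) ≤ weightedMaximal μ m f k from hk).trans
          (weightedMaximal_le μ m f k))
    _ = _ := by push_cast; ring

end RittZ

end

theorem theorem1p3 :
    (Convex ℝ≥0 RittZ.classH ∧ RittZ.StableByConvolution RittZ.classH ∧
      RittZ.StableBySymmetrization RittZ.classH) ∧
    (Convex ℝ≥0 RittZ.classR ∧ RittZ.StableByConvolution RittZ.classR ∧
      RittZ.StableBySymmetrization RittZ.classR) ∧
    (∀ μ ∈ RittZ.classH, RittZ.WeakMaximalInequality μ) ∧
    (∀ μ ∈ RittZ.classH ∩ RittZ.classR, ∀ m : ℕ,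
      RittZ.WeightedWeakMaximalInequality μ m) :=
  ⟨⟨RittZ.convex_classH, RittZ.stableByConvolution_classH, RittZ.stableBySymmetrization_classH⟩,
    ⟨RittZ.convex_classR, RittZ.stableByConvolution_classR, RittZ.stableBySymmetrization_classR⟩,
    fun _ hμ => RittZ.weakMaximalInequality_of_mem_classH hμ,
    fun _ hμ m => RittZ.weightedWeakMaximalInequality_of_mem hμ.1 hμ.2 m⟩
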